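/- Let $\mathbb{R}^{4,2}=\mathbb{R}^{1,1}\oplus\mathbb{R}^{3,1}$ with inner product $(\cdot,\cdot)$, let $(\mathfrak p,\mathfrak q)$ be an orthonormal basis of $\mathbb{R}^{1,1}$ with $|\mathfrak p|^2=-1$, $|\mathfrak q|^2=1$, put $q^\pm=\mathfrak p\pm\mathfrak q$, and for $a,b\in\mathbb{R}^{4,2}$ let $a\wedge b\in\mathfrak{o}(4,2)$ be $v\mapsto(a,v)b-(b,v)a$. Let $M$ be a connected smooth surface and let $\mathfrak f:M\to H^3\subset\mathbb{R}^{3,1}$ be a flat front without umbilics, with unit normal field $\mathfrak t$: that is, $\mathfrak f$ and $\mathfrak t$ are smooth, $(\mathfrak f,\mathfrak t)$ is a Legendrian immersion, and near each point some parallel surface $\cosh\delta\,\mathfrak f+\sinh\delta\,\mathfrak t$ is an immersion with vanishing Gauss curvature; an umbilic is a point where $d\mathfrak t$ and $d\mathfrak f$ are linearly dependent. Its Legendre lift is $f=\mathrm{span}\{\mathfrak q+\mathfrak f,\mathfrak p+\mathfrak t\}$. Then there are a smooth function $\varphi$ on $M$ and a splitting of the tangent planes into curvature directions (given by the tangent vectors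 $\partial_u$, $\partial_v$ of local curvature line coordinates $(u,v)$) with $$\cosh\varphi\,\mathfrak t_u+\sinh\varphi\,\mathfrak f_u=0=\sinh\varphi\,\mathfrak t_v+\cosh\varphi\,\mathfrak f_v .$$ For any such data, with $\star du=du$ and $\star dv=-dv$, let $s_1=\cosh\varphi(\mathfrak p+\mathfrak t)+\sinh\varphi(\mathfrak q+\mathfrak f)$, $s_2=\sinh\varphi(\mathfrak p+\mathfrak t)+\cosh\varphi(\mathfrak q+\mathfrak f)$ and $s^\pm=s_1\pm s_2$. Then $s^\pm$ are Moutard lifts of isothermic sphere congruences enveloped by $f$, that is, $s^\pm\wedge s^\pm_{uv}=0$ in all curvature line coordinates. Let $\lambda\in\mathbb{R}$, $\lambda\neq\frac12$, and let $T^\pm=T^\pm(\lambda):M\to O(4,2)$ be Calapso transformations of $s^\pm$, that is, smooth maps with $dT^\pm=T^\pm\lambda\tau^\pm$, where $\tau^\pm=s^\pm\wedge\star ds^\pm$, with constants of integration chosen so that $$T^+\bigl(1+\tfrac\lambda2 s^+\wedge s^-\bigr)=T^-\bigl(1+\tfrac\lambda2 s^-\wedge s^+\bigr)=:T(\lambda).$$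 Then the Lie geometric deformation $f(\lambda)=T(\lambda)f=T^\pm(\lambda)f$ of $f$ is again the Legendre lift of a flat front in a hyperbolic space: there are constant vectors $\mathfrak p',\mathfrak q'\in\mathbb{R}^{4,2}$ with $|\mathfrak p'|^2=-1$, $|\mathfrak q'|^2=1$, $(\mathfrak p',\mathfrak q')=0$, and a flat front $\mathfrak f'$ with unit normal field $\mathfrak t'$ in a hyperbolic space $H^3\subset\{\mathfrak p',\mathfrak q'\}^\perp$, such that $f(\lambda)=\mathrm{span}\{\mathfrak q'+\mathfrak f',\mathfrak p'+\mathfrak t'\}$. The two orientations $\mathfrak p'\pm\mathfrak q'$ of the infinity sphere of this hyperbolic space are constant multiples of $$T(\lambda)\bigl(q^\pm+\tfrac\lambda2(q^\pm,s^\mp)\,s^\pm\bigr).$$ -/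

import Mathlib

open scoped Manifold ContDiff Topology

noncomputable section

/-! ### The space `ℝ^{4,2}` of Lie sphere geometry -/

/-- The vector space underlying `ℝ^{4,2}` (its norm is only used for the topology). -/
abbrev R42 : Type := Fin 6 → ℝ

/-- The parameter plane on which surfaces are modelled. -/
abbrev E2 : Type := EuclideanSpace ℝ (Fin 2)

/-- The signs of the inner product of signature `(4,2)`. -/
def lieSign : Fin 6 → ℝ := ![-1, -1, 1, 1, 1, 1]

/-- The inner product `(x, y)` of `ℝ^{4,2}`. -/
def ip (x y : R42) : ℝ := ∑ i, lieSign i * x i * y i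

theorem ip_add_right (x y z : R42) : ip x (y + z) = ip x y + ip x z := by
  simp [ip, mul_add, Finset.sum_add_distrib]

theorem ip_smul_right (a : ℝ) (x y : R42) : ip x (a • y) = a * ip x y := by
  simp only [ip, Pi.smul_apply, smul_eq_mul, Finset.mul_sum]
  exact Finset.sum_congr rfl fun i _ => by ring

/-- The skew endomorphism `a ∧ b : v ↦ (a, v) b - (b, v) a` in `𝔬(4,2)`. -/
def wedge (a b : R42) : R42 →L[ℝ] R42 :=
  LinearMap.toContinuousLinearMap
    { toFun := fun v => ip a v • b - ip b v • a
      map_add' := fun v w => by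
        simp only [ip_add_right, add_smul]; abel
      map_smul' := fun c v => by
        simp only [ip_smul_right, mul_smul, RingHom.id_apply, smul_sub] }

/-- `(𝔭, 𝔮)` is an orthonormal basis of an `ℝ^{1,1} ⊆ ℝ^{4,2}`, with `|𝔭|² = -1` and `|𝔮|² = 1`. -/
def IsOrthonormalPair (p q : R42) : Prop :=
  ip p p = -1 ∧ ip q q = 1 ∧ ip p q = 0

/-- The hyperbolic space in `ℝ^{3,1} = {𝔭, 𝔮}^⊥` that contains `o`: the sheet through the
unit timelike vector `o` of the two-sheeted hyperboloid `|y|² = -1`. -/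
def hyperbolicSpace (p q o : R42) : Set R42 :=
  {y | ip y p = 0 ∧ ip y q = 0 ∧ ip y y = -1 ∧ ip y o < 0}

section Surface

variable {M : Type*} [TopologicalSpace M] [ChartedSpace E2 M]

/-- The differential of a vector-valued map on the surface `M`. -/
def vdiff {F : Type*} [NormedAddCommGroup F] [NormedSpace ℝ F] (g : M → F) (x : M) :
    TangentSpace 𝓘(ℝ, E2) x →L[ℝ] F :=
  mfderiv 𝓘(ℝ, E2) 𝓘(ℝ, F) g x

/-! ### Intrinsic Gauss curvature -/

/-- Partial derivative in the `i`-th coordinate of the parameter plane. -/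
def pd {F : Type*} [NormedAddCommGroup F] [NormedSpace ℝ F] (i : Fin 2) (g : E2 → F) (z : E2) : F :=
  fderiv ℝ g z (EuclideanSpace.single i 1)

/-- Gauss curvature of the metric `E du² + 2F du dv + G dv²` (Brioschi's formula). -/
def brioschi (E F G : E2 → ℝ) (z : E2) : ℝ :=
  (Matrix.det
      !![-(1 / 2) * pd 1 (pd 1 E) z + pd 1 (pd 0 F) z - (1 / 2) * pd 0 (pd 0 G) z,
          (1 / 2) * pd 0 E z, pd 0 F z - (1 / 2) * pd 1 E z;
        pd 1 F z - (1 / 2) * pd 0 G z, E z, F z;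
        (1 / 2) * pd 1 G z, F z, G z]
    - Matrix.det
      !![0, (1 / 2) * pd 1 E z, (1 / 2) * pd 0 G z;
        (1 / 2) * pd 1 E z, E z, F z;
        (1 / 2) * pd 0 G z, F z, G z])
    / (E z * G z - F z ^ 2) ^ 2

/-- Coefficient `(g_i, g_j)` of the metric induced by `g : M → ℝ^{4,2}`, in the chart at `x`. -/
def inducedMetric (g : M → R42) (x : M) (i j : Fin 2) (z : E2) : ℝ :=
  ip (pd i (g ∘ (chartAt E2 x).symm) z) (pd j (g ∘ (chartAt E2 x).symm) z)

/-- Gauss curvature at `x` of the metric induced by `g`. -/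
def gaussCurvature (g : M → R42) (x : M) : ℝ :=
  brioschi (inducedMetric g x 0 0) (inducedMetric g x 0 1) (inducedMetric g x 1 1) (chartAt E2 x x)

/-- `g` is a flat immersion at `x`: near `x`, it is an immersion with zero Gauss curvature. -/
def IsFlatImmersionAt (g : M → R42) (x : M) : Prop :=
  ∀ᶠ y in 𝓝 x, Function.Injective (vdiff g y) ∧ gaussCurvature g y = 0

/-! ### Flat fronts and their Legendre lifts -/

/-- The parallel surface of `𝔣` at signed distance `δ`, in the direction of the unit normal `𝔱`. -/
def parallelFront (f t : M → R42) (δ : ℝ) (x : M) : R42 :=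
  Real.cosh δ • f x + Real.sinh δ • t x

/-- `𝔣` is a flat front with unit normal field `𝔱` in a hyperbolic space in
`ℝ^{3,1} = {𝔭, 𝔮}^⊥`: the pair `(𝔣, 𝔱)` is a Legendrian immersion, and at each point
some parallel surface of `𝔣` is a flat immersion. -/
structure IsFlatFront (p q : R42) (f t : M → R42) : Prop where
  smooth_f : ContMDiff 𝓘(ℝ, E2) 𝓘(ℝ, R42) ∞ f
  smooth_t : ContMDiff 𝓘(ℝ, E2) 𝓘(ℝ, R42) ∞ t
  mem_hyperbolicSpace : ∃ o, ip o p = 0 ∧ ip o q = 0 ∧ ip o o = -1 ∧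
    ∀ x, f x ∈ hyperbolicSpace p q o
  normal_mem : ∀ x, ip (t x) p = 0 ∧ ip (t x) q = 0
  normal_unit : ∀ x, ip (t x) (t x) = 1
  normal_tangent : ∀ x, ip (t x) (f x) = 0
  normal_orth : ∀ x X, ip (vdiff f x X) (t x) = 0
  regular : ∀ x X, vdiff f x X = 0 → vdiff t x X = 0 → X = 0
  flat : ∀ x, ∃ δ : ℝ, IsFlatImmersionAt (parallelFront f t δ) x

/-- `x` is an umbilic: all tangent directions at `x` are curvature directions, with one and the same
curvature sphere. -/
def IsUmbilic (f t : M → R42) (x : M) : Prop :=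
  ∃ a b : ℝ, (a, b) ≠ (0, 0) ∧ ∀ X, a • vdiff t x X + b • vdiff f x X = 0

/-- The Legendre lift: the contact element `span {𝔮 + 𝔣, 𝔭 + 𝔱}` at `x`. -/
def legendreLift (p q : R42) (f t : M → R42) (x : M) : Submodule ℝ R42 :=
  Submodule.span ℝ {q + f x, p + t x}

/-! ### The enveloped isothermic sphere congruences -/

/-- A field of endomorphisms of the tangent spaces. -/
abbrev TangentEndField (M : Type*) [TopologicalSpace M] [ChartedSpace E2 M] : Type _ :=
  ∀ x : M, TangentSpace 𝓘(ℝ, E2) x →L[ℝ] TangentSpace 𝓘(ℝ, E2) x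

/-- Curvature data of a flat front. The fixed directions of the involution `J` are the curvature
directions for the principal curvature `tanh φ`, and those which `J` reverses are the curvature
directions for `coth φ`. In curvature line coordinates, `J ∂_u = ∂_u` and `J ∂_v = -∂_v`, with
`0 = 𝔱_u + tanh φ 𝔣_u = 𝔱_v + coth φ 𝔣_v`; the equations are multiplied by `cosh φ` and `sinh φ`,
so that they make sense across the singularities of `𝔣` too. -/
structure IsCurvatureData (f t : M → R42) (φ : M → ℝ) (J : TangentEndField M) : Prop where
  smooth : ContMDiff 𝓘(ℝ, E2) 𝓘(ℝ, ℝ) ∞ φ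
  involutive : ∀ x X, J x (J x X) = X
  dir_fst : ∀ x X, J x X = X →
    Real.cosh (φ x) • vdiff t x X + Real.sinh (φ x) • vdiff f x X = 0
  dir_snd : ∀ x X, J x X = -X →
    Real.sinh (φ x) • vdiff t x X + Real.cosh (φ x) • vdiff f x X = 0

/-- The curvature sphere `s₁`. -/
def curvSphere₁ (p q : R42) (f t : M → R42) (φ : M → ℝ) (x : M) : R42 :=
  Real.cosh (φ x) • (p + t x) + Real.sinh (φ x) • (q + f x)

/-- The curvature sphere `s₂`. -/
def curvSphere₂ (p q : R42) (f t : M → R42) (φ : M → ℝ) (x : M) : R42 :=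
  Real.sinh (φ x) • (p + t x) + Real.cosh (φ x) • (q + f x)

/-- The sphere congruence `s⁺ = s₁ + s₂`. -/
def sPlus (p q : R42) (f t : M → R42) (φ : M → ℝ) (x : M) : R42 :=
  curvSphere₁ p q f t φ x + curvSphere₂ p q f t φ x

/-- The sphere congruence `s⁻ = s₁ - s₂`. -/
def sMinus (p q : R42) (f t : M → R42) (φ : M → ℝ) (x : M) : R42 :=
  curvSphere₁ p q f t φ x - curvSphere₂ p q f t φ x

/-- `c : U → M` is a parametrization of `M` by curvature line coordinates `(u, v)`. -/
def IsCurvatureLineParam (J : TangentEndField M) (U : Set (ℝ × ℝ)) (c : ℝ × ℝ → M) : Prop :=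
  IsOpen U ∧ ContMDiffOn 𝓘(ℝ, ℝ × ℝ) 𝓘(ℝ, E2) ∞ c U ∧ ∀ z ∈ U,
    Function.Injective (mfderiv 𝓘(ℝ, ℝ × ℝ) 𝓘(ℝ, E2) c z) ∧
    J (c z) (mfderiv 𝓘(ℝ, ℝ × ℝ) 𝓘(ℝ, E2) c z ((1, 0) : ℝ × ℝ)) =
      mfderiv 𝓘(ℝ, ℝ × ℝ) 𝓘(ℝ, E2) c z ((1, 0) : ℝ × ℝ) ∧
    J (c z) (mfderiv 𝓘(ℝ, ℝ × ℝ) 𝓘(ℝ, E2) c z ((0, 1) : ℝ × ℝ)) =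
      -mfderiv 𝓘(ℝ, ℝ × ℝ) 𝓘(ℝ, E2) c z ((0, 1) : ℝ × ℝ)

/-- `s` is a Moutard lift of an isothermic sphere congruence: `s ∧ s_{uv} = 0` in all curvature
line coordinates. -/
def IsMoutardLift (J : TangentEndField M) (s : M → R42) : Prop :=
  ContMDiff 𝓘(ℝ, E2) 𝓘(ℝ, R42) ∞ s ∧
  ∀ (U : Set (ℝ × ℝ)) (c : ℝ × ℝ → M), IsCurvatureLineParam J U c → ∀ z ∈ U,
    wedge (s (c z))
      (fderiv ℝ (fun w => fderiv ℝ (s ∘ c) w ((1, 0) : ℝ × ℝ)) z ((0, 1) : ℝ × ℝ)) = 0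

/-! ### Calapso transformations and the Lie geometric deformation -/

/-- The `𝔬(4,2)`-valued 1-form `τ = s ∧ ⋆ds`, where `(⋆ω)(X) = ω(J X)`, that is,
`⋆du = du` and `⋆dv = -dv` in curvature line coordinates. -/
def calapsoForm (J : TangentEndField M) (s : M → R42) (x : M) (X : TangentSpace 𝓘(ℝ, E2) x) :
    R42 →L[ℝ] R42 :=
  wedge (s x) (vdiff s x (J x X))

/-- `T : M → O(4,2)` is a Calapso transformation with parameter `lam` of the isothermic sphere
congruence with Moutard lift `s`: `dT = T lam τ`. -/
structure IsCalapso (J : TangentEndField M) (s : M → R42) (lam : ℝ) (T : M → R42 →L[ℝ] R42) :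
    Prop where
  smooth : ContMDiff 𝓘(ℝ, E2) 𝓘(ℝ, R42 →L[ℝ] R42) ∞ T
  orthogonal : ∀ x v w, ip (T x v) (T x w) = ip v w
  deriv_eq : ∀ x X, vdiff T x X = (T x).comp (lam • calapsoForm J s x X)

/-- `T` yields the Lie geometric deformation with parameter `lam`:
`T = T⁺ (1 + (lam/2) s⁺ ∧ s⁻) = T⁻ (1 + (lam/2) s⁻ ∧ s⁺)` for Calapso transformations `T⁺`, `T⁻` of
`s⁺`, `s⁻`. -/
structure IsLieDeformation (J : TangentEndField M) (sp sm : M → R42) (lam : ℝ)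
    (Tp Tm T : M → R42 →L[ℝ] R42) : Prop where
  calapso_plus : IsCalapso J sp lam Tp
  calapso_minus : IsCalapso J sm lam Tm
  eq_plus : ∀ x, T x =
    (Tp x).comp (ContinuousLinearMap.id ℝ R42 + (lam / 2) • wedge (sp x) (sm x))
  eq_minus : ∀ x, T x =
    (Tm x).comp (ContinuousLinearMap.id ℝ R42 + (lam / 2) • wedge (sm x) (sp x))

end Surface

end

/-! ### Algebra of the inner product -/

/-! The proof rests on one quadratic form. The vectors 𝔭, 𝔮, 𝔣, 𝔱 are orthonormal and two of them
are timelike, so d𝔣 and d𝔱 take values in a positive definite plane, which carries the area form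
`areaForm`. At a regular point the Gauss equation (`brioschi_eq`) reads K = det II / det I - 1. By
`areaForm_mul`, det I is the square of the area of d𝔣 and det II is the product of the areas of d𝔣
and d𝔱; thus K = 0 means that d𝔣 and d𝔱 have equal areas. That condition is invariant under
hyperbolic rotations of (𝔣, 𝔱), so it passes from a regular parallel surface to the front itself,
singular points included (`IsFlatFront.areaForm_pencil_ne_zero`). Hence a d𝔣 + b d𝔱 has area (a² +
b²) D + 2ab H, which is symmetric in a and b.

Absence of umbilics gives D² < H² (`IsFlatFront.areaFst_sq_lt`), a discriminant being positive. So D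
cosh 2φ + H sinh 2φ = 0 for exactly one φ (`hypAngle_iff`). By symmetry both cosh φ d𝔣 + sinh φ d𝔱
and sinh φ d𝔣 + cosh φ d𝔱 are then singular, and their kernels are the curvature directions.

The curvature equations say that s₁ changes along s₂ in the u-direction and s₂ along s₁ in the
v-direction, both at the rate of φ; cross-differentiation gives the Moutard equations for s₁ ± s₂
(`fderiv_fderiv_add_eq_smul`).

For the deformation, s^± is orthogonal to q^±, so T⁺q⁺ and T⁻q⁻ are constant null vectors. Their
product is -2(1 - 2λ), nonzero because λ ≠ 1/2, and after rescaling they give 𝔭' ± 𝔮'. Since s⁺ and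
ds⁺ are orthogonal to f, T⁺ acts on sections of f like a constant map (`IsCalapso.vdiff_apply`). The
new front and normal therefore have differentials T⁺((1-λ) d𝔣 - λ d𝔱) and T⁺(-λ d𝔣 + (1-λ) d𝔱). This
substitution has determinant 1 - 2λ and commutes with exchanging d𝔣 and d𝔱, so it preserves the
Legendre immersion property and the equality of areas, that is, flatness (`IsFlatFront.of_pencil`).
-/

theorem ip_comm (x y : R42) : ip x y = ip y x :=
  Finset.sum_congr rfl fun i _ => by ring

theorem ip_add_left (x y z : R42) : ip (x + y) z = ip x z + ip y z := by
  rw [ip_comm, ip_add_right, ip_comm z x, ip_comm z y]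

theorem ip_smul_left (a : ℝ) (x y : R42) : ip (a • x) y = a * ip x y := by
  rw [ip_comm, ip_smul_right, ip_comm]

theorem ip_neg_right (x y : R42) : ip x (-y) = -ip x y := by
  rw [← neg_one_smul ℝ y, ip_smul_right, neg_one_mul]

theorem ip_sub_right (x y z : R42) : ip x (y - z) = ip x y - ip x z := by
  rw [sub_eq_add_neg, ip_add_right, ip_neg_right, sub_eq_add_neg]

theorem ip_sub_left (x y z : R42) : ip (x - y) z = ip x z - ip y z := by
  rw [ip_comm, ip_sub_right, ip_comm z x, ip_comm z y]

theorem ip_zero_right (x : R42) : ip x 0 = 0 := by simp [ip]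

theorem ip_zero_left (x : R42) : ip 0 x = 0 := by simp [ip]

theorem wedge_apply (a b v : R42) : wedge a b v = ip a v • b - ip b v • a := rfl

/-- The inner product as a continuous bilinear map. -/
noncomputable def ipBilin : R42 →L[ℝ] R42 →L[ℝ] ℝ :=
  (LinearMap.mk₂ ℝ ip ip_add_left ip_smul_left ip_add_right ip_smul_right).toContinuousBilinearMap

@[simp] theorem ipBilin_apply (x y : R42) : ipBilin x y = ip x y := rfl

/-- The orthogonal complement of two orthogonal unit timelike vectors is positive definite. -/
theorem eq_zero_of_ip_self_nonpos {p o X : R42} (hp : ip p p = -1) (ho : ip o o = -1)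
    (hpo : ip p o = 0) (hXp : ip X p = 0) (hXo : ip X o = 0) (hX : ip X X ≤ 0) : X = 0 := by
  -- Three vectors have a nontrivial combination whose two timelike coordinates vanish. Its square
  -- norm is nonnegative in coordinates and nonpositive by orthogonality, so all terms are zero.
  let m : (Fin 3 → ℝ) →ₗ[ℝ] (Fin 2 → ℝ) :=
    Matrix.toLin' !![p 0, o 0, X 0; p 1, o 1, X 1]
  obtain ⟨c, hc, hc0⟩ := (Submodule.ne_bot_iff _).1
    (LinearMap.ker_ne_bot_of_finrank_lt (f := m) (by simp))
  have e := LinearMap.mem_ker.1 hc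
  have e0 := congrFun e 0
  have e1 := congrFun e 1
  simp [m, Matrix.mulVec, dotProduct, Fin.sum_univ_succ] at e0 e1
  set V : R42 := c 0 • p + c 1 • o + c 2 • X with hV
  have hV0 : V 0 = 0 := by simp [hV]; linarith
  have hV1 : V 1 = 0 := by simp [hV]; linarith
  have h1 : ip V V = -(c 0) ^ 2 - (c 1) ^ 2 + (c 2) ^ 2 * ip X X := by
    simp only [hV, ip_add_left, ip_add_right, ip_smul_left, ip_smul_right, hp, ho, hpo, hXp, hXo,
      ip_comm o p, ip_comm p X, ip_comm o X]
    ring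
  have h2 : ip V V = (V 2) ^ 2 + (V 3) ^ 2 + (V 4) ^ 2 + (V 5) ^ 2 := by
    simp [ip, lieSign, Fin.sum_univ_succ, hV0, hV1]
    ring
  have h3 : (c 2) ^ 2 * ip X X ≤ 0 := mul_nonpos_of_nonneg_of_nonpos (sq_nonneg _) hX
  have i0 := sq_nonneg (c 0)
  have i1 := sq_nonneg (c 1)
  have i2 := sq_nonneg (V 2)
  have i3 := sq_nonneg (V 3)
  have i4 := sq_nonneg (V 4)
  have i5 := sq_nonneg (V 5)
  have hV2 : V 2 = 0 := pow_eq_zero_iff two_ne_zero |>.1 (by linarith)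
  have hV3 : V 3 = 0 := pow_eq_zero_iff two_ne_zero |>.1 (by linarith)
  have hV4 : V 4 = 0 := pow_eq_zero_iff two_ne_zero |>.1 (by linarith)
  have hV5 : V 5 = 0 := pow_eq_zero_iff two_ne_zero |>.1 (by linarith)
  have z : V = 0 := by
    ext i
    fin_cases i <;> assumption
  have z0 : c 0 = 0 := by
    rw [z, ip_zero_left] at h1
    exact pow_eq_zero_iff two_ne_zero |>.1 (by linarith)
  have z1 : c 1 = 0 := by
    rw [z, ip_zero_left] at h1
    exact pow_eq_zero_iff two_ne_zero |>.1 (by linarith)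
  have z2 : c 2 ≠ 0 := fun h => hc0 (by ext i; fin_cases i <;> simp [z0, z1, h])
  rw [hV, z0, z1] at z
  simpa [z2] using z

/-- `p`, `q`, `f`, `t` are orthonormal of signs `-1`, `1`, `-1`, `1`. -/
structure IsFrame (p q f t : R42) : Prop where
  pp : ip p p = -1
  qq : ip q q = 1
  ff : ip f f = -1
  tt : ip t t = 1
  pq : ip p q = 0
  fp : ip f p = 0
  fq : ip f q = 0
  tp : ip t p = 0
  tq : ip t q = 0
  tf : ip t f = 0

/-- `X` is orthogonal to `p`, `q`, `f`, `t`. -/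
structure IsPerp (p q f t X : R42) : Prop where
  p : ip X p = 0
  q : ip X q = 0
  f : ip X f = 0
  t : ip X t = 0

/-- The area form of the orthogonal complement of `p`, `q`, `f`, `t`. -/
noncomputable def areaForm (p q f t X Y : R42) : ℝ :=
  Matrix.det (Matrix.of ![p, q, f, t, X, Y])

/-! ### The area form on the plane orthogonal to the frame -/

section Area

variable {p q f t X Y Z W : R42}

theorem IsPerp.add (hX : IsPerp p q f t X) (hY : IsPerp p q f t Y) : IsPerp p q f t (X + Y) := by
  constructor <;> simp [ip_add_left, hX.p, hX.q, hX.f, hX.t, hY.p, hY.q, hY.f, hY.t]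

theorem IsPerp.smul (a : ℝ) (hX : IsPerp p q f t X) : IsPerp p q f t (a • X) := by
  constructor <;> simp [ip_smul_left, hX.p, hX.q, hX.f, hX.t]

/-- Gram determinants are multiplicative: the matrix of products of the two sextuples splits into
diag(-1, 1, -1, 1) and a 2 × 2 block. The frame and the ambient form both have sign determinant 1,
so no sign appears. -/
theorem areaForm_mul (h : IsFrame p q f t) (hX : IsPerp p q f t X) (hY : IsPerp p q f t Y)
    (hZ : IsPerp p q f t Z) (hW : IsPerp p q f t W) :
    areaForm p q f t X Y * areaForm p q f t Z W = ip X Z * ip Y W - ip X W * ip Y Z := by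
  have key : Matrix.of ![p, q, f, t, X, Y] * Matrix.diagonal lieSign *
      (Matrix.of ![p, q, f, t, Z, W]).transpose =
      !![-1, 0, 0, 0, 0, 0; 0, 1, 0, 0, 0, 0; 0, 0, -1, 0, 0, 0; 0, 0, 0, 1, 0, 0;
        0, 0, 0, 0, ip X Z, ip X W; 0, 0, 0, 0, ip Y Z, ip Y W] := by
    have e : ∀ (m n : Fin 6 → R42), Matrix.of m * Matrix.diagonal lieSign *
        (Matrix.of n).transpose = Matrix.of fun i j => ip (m i) (n j) := by
      intro m n
      ext i j
      rw [Matrix.mul_apply]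
      simp only [Matrix.mul_diagonal, Matrix.of_apply, Matrix.transpose_apply, ip]
      exact Finset.sum_congr rfl fun k _ => by ring
    rw [e]
    ext i j
    fin_cases i <;> fin_cases j <;>
      simp [h.pp, h.qq, h.ff, h.tt, h.pq, h.fp, h.fq, h.tp, h.tq, h.tf, ip_comm q p, ip_comm p f,
        ip_comm q f, ip_comm p t, ip_comm q t, ip_comm f t, hX.p, hX.q, hX.f, hX.t, hY.p, hY.q,
        hY.f, hY.t, ip_comm p Z, ip_comm q Z, ip_comm f Z, ip_comm t Z, hZ.p, hZ.q, hZ.f, hZ.t,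
        ip_comm p W, ip_comm q W, ip_comm f W, ip_comm t W, hW.p, hW.q, hW.f, hW.t]
  have d := congrArg Matrix.det key
  rw [Matrix.det_mul, Matrix.det_mul, Matrix.det_transpose, Matrix.det_diagonal] at d
  have l : ∏ i, lieSign i = 1 := by simp [lieSign, Fin.prod_univ_succ]
  rw [l, mul_one] at d
  rw [areaForm, areaForm, d]
  simp [Matrix.det_succ_row_zero, Fin.sum_univ_succ, Fin.succAbove]
  ring

/-- A nonzero area makes the six vectors a basis, and the inner product is nondegenerate. -/
theorem eq_zero_of_isPerp (h : areaForm p q f t X Y ≠ 0) (hZ : IsPerp p q f t Z)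
    (hX : ip Z X = 0) (hY : ip Z Y = 0) : Z = 0 := by
  have e : ∀ m : Fin 6 → R42, Matrix.mulVec (Matrix.of m) (fun i => lieSign i * Z i) =
      fun i => ip Z (m i) := by
    intro m
    ext i
    simp only [Matrix.mulVec, dotProduct, ip, Matrix.of_apply]
    exact Finset.sum_congr rfl fun j _ => by ring
  have z := Matrix.eq_zero_of_mulVec_eq_zero h (v := fun i => lieSign i * Z i) (by
    rw [e]
    ext i
    fin_cases i <;> simp [hZ.p, hZ.q, hZ.f, hZ.t, hX, hY])
  ext i
  have := congrFun z i
  fin_cases i <;> simpa [lieSign] using this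

theorem areaForm_add_left (X' : R42) :
    areaForm p q f t (X + X') Y = areaForm p q f t X Y + areaForm p q f t X' Y := by
  have := Matrix.det_updateRow_add (Matrix.of ![p, q, f, t, 0, Y]) 4 X X'
  have e : ∀ V : R42, (Matrix.of ![p, q, f, t, 0, Y]).updateRow 4 V =
      Matrix.of ![p, q, f, t, V, Y] := by
    intro V; ext i j; fin_cases i <;> simp [Matrix.updateRow_apply]
  simpa only [e, areaForm] using this

theorem areaForm_smul_left (a : ℝ) :
    areaForm p q f t (a • X) Y = a * areaForm p q f t X Y := by
  have := Matrix.det_updateRow_smul (Matrix.of ![p, q, f, t, 0, Y]) 4 a X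
  have e : ∀ V : R42, (Matrix.of ![p, q, f, t, 0, Y]).updateRow 4 V =
      Matrix.of ![p, q, f, t, V, Y] := by
    intro V; ext i j; fin_cases i <;> simp [Matrix.updateRow_apply]
  simpa only [e, areaForm] using this

theorem areaForm_self : areaForm p q f t X X = 0 :=
  Matrix.det_zero_of_row_eq (i := 4) (j := 5) (by decide) rfl

theorem areaForm_add_right (Y' : R42) :
    areaForm p q f t X (Y + Y') = areaForm p q f t X Y + areaForm p q f t X Y' := by
  have := Matrix.det_updateRow_add (Matrix.of ![p, q, f, t, X, 0]) 5 Y Y'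
  have e : ∀ V : R42, (Matrix.of ![p, q, f, t, X, 0]).updateRow 5 V =
      Matrix.of ![p, q, f, t, X, V] := by
    intro V; ext i j; fin_cases i <;> simp [Matrix.updateRow_apply]
  simpa only [e, areaForm] using this

theorem areaForm_smul_right (a : ℝ) :
    areaForm p q f t X (a • Y) = a * areaForm p q f t X Y := by
  have := Matrix.det_updateRow_smul (Matrix.of ![p, q, f, t, X, 0]) 5 a Y
  have e : ∀ V : R42, (Matrix.of ![p, q, f, t, X, 0]).updateRow 5 V =
      Matrix.of ![p, q, f, t, X, V] := by
    intro V; ext i j; fin_cases i <;> simp [Matrix.updateRow_apply]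
  simpa only [e, areaForm] using this

theorem areaForm_swap : areaForm p q f t Y X = -areaForm p q f t X Y := by
  have h : areaForm p q f t (X + Y) (X + Y) = 0 := areaForm_self
  rw [areaForm_add_left, areaForm_add_right, areaForm_add_right, areaForm_self,
    areaForm_self] at h
  linarith

theorem IsPerp.eq_zero (h : IsFrame p q f t) (hX : IsPerp p q f t X) (h0 : ip X X ≤ 0) : X = 0 :=
  eq_zero_of_ip_self_nonpos h.pp h.ff (by rw [ip_comm, h.fp]) hX.p hX.f h0

/-- Vectors of vanishing area are linearly dependent. -/
theorem exists_smul_add_eq_zero (h : IsFrame p q f t) (hX : IsPerp p q f t X)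
    (hY : IsPerp p q f t Y) (h0 : areaForm p q f t X Y = 0) :
    ∃ a b : ℝ, (a, b) ≠ (0, 0) ∧ a • X + b • Y = 0 := by
  by_cases hX0 : X = 0
  · exact ⟨1, 0, by simp, by simp [hX0]⟩
  have hp : ip X X ≠ 0 := fun e => hX0 (hX.eq_zero h e.le)
  -- The square norm of this combination is `ip X X` times the Gram determinant of `X`, `Y`, which
  -- is the squared area and hence zero.
  refine ⟨-ip X Y, ip X X, by simp [hp], ((hX.smul _).add (hY.smul _)).eq_zero h ?_⟩
  have g := areaForm_mul h hX hY hX hY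
  rw [h0, mul_zero, ip_comm Y X] at g
  simp only [ip_add_left, ip_add_right, ip_smul_left, ip_smul_right, ip_comm Y X]
  have : ip X X * (ip X X * ip Y Y - ip X Y * ip X Y) = 0 := by rw [← g, mul_zero]
  linarith

end Area

/-! ### Differentials on the surface, read in charts -/

section Calculus

variable {M : Type*} [TopologicalSpace M] [ChartedSpace E2 M]
variable {F : Type*} [NormedAddCommGroup F] [NormedSpace ℝ F]

theorem vdiff_apply {g : M → F} {x : M} (hg : MDifferentiableAt 𝓘(ℝ, E2) 𝓘(ℝ, F) g x) (v : E2) :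
    vdiff g x v = fderiv ℝ (g ∘ (chartAt E2 x).symm) (chartAt E2 x x) v := by
  have := congrArg (fun L : E2 →L[ℝ] F => L v) hg.mfderiv
  simp only [writtenInExtChartAt, mfld_simps, fderivWithin_univ] at this
  exact this

theorem differentiableAt_comp_symm {g : M → F} {x : M}
    (hg : MDifferentiableAt 𝓘(ℝ, E2) 𝓘(ℝ, F) g x) :
    DifferentiableAt ℝ (g ∘ (chartAt E2 x).symm) (chartAt E2 x x) := by
  have := hg.differentiableWithinAt_writtenInExtChartAt
  simp only [writtenInExtChartAt, mfld_simps] at this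
  exact differentiableWithinAt_univ.1 this

variable [IsManifold 𝓘(ℝ, E2) ∞ M]

theorem contDiffOn_comp_symm {g : M → F} (hg : ContMDiff 𝓘(ℝ, E2) 𝓘(ℝ, F) ∞ g) (x : M) :
    ContDiffOn ℝ ∞ (g ∘ (chartAt E2 x).symm) (chartAt E2 x).target :=
  contMDiffOn_iff_contDiffOn.1
    (hg.comp_contMDiffOn (contMDiffOn_chart_symm (I := 𝓘(ℝ, E2)) (x := x)))

theorem mdifferentiableAt_symm (x : M) {z : E2} (hz : z ∈ (chartAt E2 x).target) :
    MDifferentiableAt 𝓘(ℝ, E2) 𝓘(ℝ, E2) (chartAt E2 x).symm z :=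
  ((contMDiffOn_chart_symm (I := 𝓘(ℝ, E2)) (n := ∞) (x := x)).contMDiffAt
    ((chartAt E2 x).open_target.mem_nhds hz)).mdifferentiableAt (by simp)

theorem fderiv_comp_symm {g : M → F} (hg : ContMDiff 𝓘(ℝ, E2) 𝓘(ℝ, F) ∞ g) (x : M) {z : E2}
    (hz : z ∈ (chartAt E2 x).target) (v : E2) :
    fderiv ℝ (g ∘ (chartAt E2 x).symm) z v =
      vdiff g ((chartAt E2 x).symm z)
        (mfderiv 𝓘(ℝ, E2) 𝓘(ℝ, E2) (chartAt E2 x).symm z v) := by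
  have := mfderiv_comp z (hg.mdifferentiableAt (by simp)) (mdifferentiableAt_symm x hz)
  rw [mfderiv_eq_fderiv] at this
  exact congrArg (fun L : E2 →L[ℝ] F => L v) this

/-- Injectivity is an open condition on linear maps, but `vdiff g y` refers to the chart at `y`. It
is compared with the derivative in the fixed chart at `x` through the differential of the inverse
chart, which is injective because the composite is, hence bijective by dimension. -/
theorem eventually_injective_vdiff {g : M → F}
    (hg : ContMDiff 𝓘(ℝ, E2) 𝓘(ℝ, F) ∞ g) {x : M} (hx : Function.Injective (vdiff g x)) :
    ∀ᶠ y in 𝓝 x, Function.Injective (vdiff g y) := by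
  set e := chartAt E2 x with he
  have hc : ContinuousOn (fderiv ℝ (g ∘ e.symm)) e.target :=
    (contDiffOn_comp_symm hg x).continuousOn_fderiv_of_isOpen e.open_target (by simp)
  have hx' : Function.Injective (fderiv ℝ (g ∘ e.symm) (e x)) := by
    intro a b hab
    rw [← vdiff_apply (hg.mdifferentiableAt (by simp)),
      ← vdiff_apply (hg.mdifferentiableAt (by simp))] at hab
    exact hx hab
  have hc' := hc.continuousAt (e.open_target.mem_nhds (mem_chart_target E2 x))
  have h1 := hc'.comp (e.continuousAt (mem_chart_source E2 x))
  have h2 := h1.eventually (ContinuousLinearMap.isOpen_injective.mem_nhds hx')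
  filter_upwards [h2, e.open_source.mem_nhds (mem_chart_source E2 x)] with y hy hys
  have hy' : Function.Injective (fderiv ℝ (g ∘ e.symm) (e y)) := hy
  have hf := fun v => fderiv_comp_symm hg x (e.map_source hys) v
  rw [e.left_inv hys] at hf
  set P : E2 →L[ℝ] E2 := mfderiv 𝓘(ℝ, E2) 𝓘(ℝ, E2) e.symm (e y) with hP
  have hPi : Function.Injective P := fun a b hab => hy' (by
    rw [hf, hf]
    exact congrArg _ hab)
  have hPs : Function.Surjective P := LinearMap.injective_iff_surjective (f := P.toLinearMap).1 hPi
  intro a b hab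
  obtain ⟨a', rfl⟩ := hPs a
  obtain ⟨b', rfl⟩ := hPs b
  rw [hy' ((hf a').trans (hab.trans (hf b').symm))]

theorem eq_of_vdiff_eq_zero [ConnectedSpace M] {g : M → F}
    (hg : ContMDiff 𝓘(ℝ, E2) 𝓘(ℝ, F) ∞ g) (h : ∀ x, vdiff g x = 0) (x y : M) : g x = g y := by
  have hl : IsLocallyConstant g := by
    rw [IsLocallyConstant.iff_eventually_eq]
    intro x
    set e := chartAt E2 x with he
    obtain ⟨r, hr, hb⟩ := Metric.isOpen_iff.1 e.open_target _ (mem_chart_target E2 x)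
    have hs : e ⁻¹' Metric.ball (e x) r ∈ 𝓝 x :=
      (e.continuousAt (mem_chart_source E2 x)).preimage_mem_nhds (Metric.ball_mem_nhds _ hr)
    filter_upwards [hs, e.open_source.mem_nhds (mem_chart_source E2 x)] with y hy hys
    have hd : DifferentiableOn ℝ (g ∘ e.symm) (Metric.ball (e x) r) :=
      ((contDiffOn_comp_symm hg x).mono hb).differentiableOn (by simp)
    have := Metric.isOpen_ball.is_const_of_fderiv_eq_zero
      (convex_ball (e x) r).isPreconnected hd (fun z hz => by
        ext v
        rw [fderiv_comp_symm hg x (hb hz), h]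
        rfl) hy (Metric.mem_ball_self hr)
    simpa [e.left_inv hys, e.left_inv (mem_chart_source E2 x)] using this
  exact hl.apply_eq_of_preconnectedSpace x y

end Calculus

/-! ### The Gauss equation in hyperbolic space -/

section Gauss

variable {F : Type*} [NormedAddCommGroup F] [NormedSpace ℝ F] {Ω : Set E2}

theorem contDiffOn_pd (hΩ : IsOpen Ω) (i : Fin 2) {g : E2 → F} (hg : ContDiffOn ℝ ∞ g Ω) :
    ContDiffOn ℝ ∞ (pd i g) Ω :=
  (hg.fderiv_of_isOpen hΩ (by simp)).clm_apply contDiffOn_const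

theorem differentiableAt_of_contDiffOn (hΩ : IsOpen Ω) {g : E2 → F} (hg : ContDiffOn ℝ ∞ g Ω)
    {z : E2} (hz : z ∈ Ω) : DifferentiableAt ℝ g z :=
  (hg.differentiableOn (by simp)).differentiableAt (hΩ.mem_nhds hz)

theorem pd_congr (hΩ : IsOpen Ω) (i : Fin 2) {g h : E2 → F} (e : ∀ z ∈ Ω, g z = h z) {z : E2}
    (hz : z ∈ Ω) : pd i g z = pd i h z := by
  rw [pd, pd, Filter.EventuallyEq.fderiv_eq (Filter.eventually_of_mem (hΩ.mem_nhds hz) e)]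

theorem hasFDerivAt_ip {E : Type*} [NormedAddCommGroup E] [NormedSpace ℝ E] {g h : E → R42} {z : E}
    {g' h' : E →L[ℝ] R42} (hg : HasFDerivAt g g' z) (hh : HasFDerivAt h h' z) :
    HasFDerivAt (fun w => ip (g w) (h w))
      (ipBilin.precompR E (g z) h' + ipBilin.precompL E g' (h z)) z :=
  ipBilin.hasFDerivAt_of_bilinear hg hh

theorem ContDiffOn.ip {E : Type*} [NormedAddCommGroup E] [NormedSpace ℝ E] {s : Set E}
    {g h : E → R42} (hg : ContDiffOn ℝ ∞ g s) (hh : ContDiffOn ℝ ∞ h s) :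
    ContDiffOn ℝ ∞ (fun w => ip (g w) (h w)) s :=
  (ipBilin.contDiff.comp_contDiffOn hg).clm_apply hh

variable {g h : E2 → R42}

theorem pd_ip (hΩ : IsOpen Ω) (i : Fin 2) (hg : ContDiffOn ℝ ∞ g Ω) (hh : ContDiffOn ℝ ∞ h Ω)
    {z : E2} (hz : z ∈ Ω) :
    pd i (fun w => ip (g w) (h w)) z = ip (pd i g z) (h z) + ip (g z) (pd i h z) := by
  rw [pd, (hasFDerivAt_ip (differentiableAt_of_contDiffOn hΩ hg hz).hasFDerivAt
    (differentiableAt_of_contDiffOn hΩ hh hz).hasFDerivAt).fderiv]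
  simp [pd, add_comm]

theorem pd_add (hΩ : IsOpen Ω) (i : Fin 2) {a b : E2 → ℝ} (ha : ContDiffOn ℝ ∞ a Ω)
    (hb : ContDiffOn ℝ ∞ b Ω) {z : E2} (hz : z ∈ Ω) :
    pd i (fun w => a w + b w) z = pd i a z + pd i b z := by
  rw [pd, fderiv_fun_add (differentiableAt_of_contDiffOn hΩ ha hz)
    (differentiableAt_of_contDiffOn hΩ hb hz)]
  rfl

theorem pd_const (i : Fin 2) (c : F) (z : E2) : pd i (fun _ => c) z = 0 := by
  simp [pd]

theorem pd_pd_ip (hΩ : IsOpen Ω) (i j : Fin 2) (hg : ContDiffOn ℝ ∞ g Ω)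
    (hh : ContDiffOn ℝ ∞ h Ω) {z : E2} (hz : z ∈ Ω) :
    pd j (pd i (fun w => ip (g w) (h w))) z = ip (pd j (pd i g) z) (h z) + ip (pd i g z) (pd j h z)
      + (ip (pd j g z) (pd i h z) + ip (g z) (pd j (pd i h) z)) := by
  have gi := contDiffOn_pd hΩ i hg
  have hi := contDiffOn_pd hΩ i hh
  rw [pd_congr hΩ j (fun w hw => pd_ip hΩ i hg hh hw) hz, pd_add hΩ j (gi.ip hh) (hg.ip hi) hz,
    pd_ip hΩ j gi hh hz, pd_ip hΩ j hg hi hz]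

theorem pd_comm (hΩ : IsOpen Ω) {g : E2 → F} (hg : ContDiffOn ℝ ∞ g Ω) {z : E2} (hz : z ∈ Ω)
    (i j : Fin 2) : pd i (pd j g) z = pd j (pd i g) z := by
  have hd : DifferentiableAt ℝ (fderiv ℝ g) z :=
    ((hg.fderiv_of_isOpen hΩ (m := ∞) (by simp)).differentiableOn (by simp)).differentiableAt
      (hΩ.mem_nhds hz)
  have hs : IsSymmSndFDerivAt ℝ g z :=
    (hg.contDiffAt (hΩ.mem_nhds hz)).isSymmSndFDerivAt (by
      simp only [minSmoothness_of_isRCLikeNormedField]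
      exact WithTop.coe_le_coe.2 (le_top (a := (2 : ℕ∞))))
  have e : ∀ i j : Fin 2, pd i (pd j g) z =
      fderiv ℝ (fderiv ℝ g) z (EuclideanSpace.single i 1) (EuclideanSpace.single j 1) := by
    intro i j
    unfold pd
    rw [fderiv_clm_apply hd (differentiableAt_const _)]
    simp
  rw [e, e]
  exact hs _ _

/-- The component of vectors orthogonal to `p`, `q` in the tangent plane spanned by `X`, `Y`. -/
theorem gram_eq {p q f t X Y : R42} (hF : IsFrame p q f t) (hX : IsPerp p q f t X)
    (hY : IsPerp p q f t Y) (h0 : areaForm p q f t X Y ≠ 0) {P Q : R42} (hPp : ip P p = 0)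
    (hPq : ip P q = 0) :
    (ip X X * ip Y Y - ip X Y ^ 2) * (ip P Q - ip P t * ip Q t + ip P f * ip Q f) =
      (ip P X * ip Y Y - ip P Y * ip X Y) * ip X Q +
        (ip P Y * ip X X - ip P X * ip X Y) * ip Y Q := by
  -- `Z` is the Gram determinant times the difference between `P` and its projection to the span of
  -- `f`, `t`, `X`, `Y`, with tangential coefficients from Cramer's rule. It is orthogonal to a
  -- basis, so it vanishes.
  set Z : R42 := (ip X X * ip Y Y - ip X Y ^ 2) • (P - ip P t • t + ip P f • f) -
    (ip P X * ip Y Y - ip P Y * ip X Y) • X - (ip P Y * ip X X - ip P X * ip X Y) • Y with hZ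
  have hZ0 : Z = 0 := by
    refine eq_zero_of_isPerp h0 (X := X) (Y := Y) ⟨?_, ?_, ?_, ?_⟩ ?_ ?_ <;>
    · simp only [hZ, ip_add_left, ip_sub_left, ip_smul_left, hX.p, hX.q, hX.f, hX.t, hY.p, hY.q,
        hY.f, hY.t, hF.tp, hF.tq, hF.tf, hF.tt, hF.fp, hF.fq, hF.ff, hPp, hPq, ip_comm f t,
        ip_comm f X, ip_comm f Y, ip_comm t X, ip_comm t Y, ip_comm Y X]
      ring
  have := congrArg (ip · Q) hZ0
  simp only [hZ, ip_add_left, ip_sub_left, ip_smul_left, ip_zero_left, ip_comm t Q,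
    ip_comm f Q] at this
  linarith

/-- Symmetry of the second fundamental form: both sides equal minus the normal component of the
mixed second derivative. -/
theorem ip_pd_comm {r n : E2 → R42} (hΩ : IsOpen Ω) (hr : ContDiffOn ℝ ∞ r Ω)
    (hn : ContDiffOn ℝ ∞ n Ω) (ho : ∀ z ∈ Ω, ∀ i, ip (pd i r z) (n z) = 0) {z : E2} (hz : z ∈ Ω)
    (i j : Fin 2) : ip (pd i r z) (pd j n z) = ip (pd j r z) (pd i n z) := by
  have rijn : ∀ i j, ip (pd j (pd i r) z) (n z) = -ip (pd i r z) (pd j n z) := fun i j => by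
    have := pd_ip hΩ j (contDiffOn_pd hΩ i hr) hn hz
    rw [pd_congr hΩ j (fun y hy => ho y hy i) hz, pd_const] at this
    linarith
  have h1 := rijn i j
  have h2 := rijn j i
  rw [pd_comm hΩ hr hz] at h2
  linarith

/-- The Gauss equation for a surface with unit normal in hyperbolic space. -/
theorem brioschi_eq {p q : R42} {r n : E2 → R42} (hΩ : IsOpen Ω) (hr : ContDiffOn ℝ ∞ r Ω)
    (hn : ContDiffOn ℝ ∞ n Ω) (hF : ∀ z ∈ Ω, IsFrame p q (r z) (n z))
    (ho : ∀ z ∈ Ω, ∀ i, ip (pd i r z) (n z) = 0) {z : E2} (hz : z ∈ Ω)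
    (h0 : areaForm p q (r z) (n z) (pd 0 r z) (pd 1 r z) ≠ 0) :
    brioschi (fun w => ip (pd 0 r w) (pd 0 r w)) (fun w => ip (pd 0 r w) (pd 1 r w))
      (fun w => ip (pd 1 r w) (pd 1 r w)) z =
    ((ip (pd 0 r z) (pd 0 n z) * ip (pd 1 r z) (pd 1 n z) -
        ip (pd 0 r z) (pd 1 n z) * ip (pd 1 r z) (pd 0 n z)) -
      (ip (pd 0 r z) (pd 0 r z) * ip (pd 1 r z) (pd 1 r z) - ip (pd 0 r z) (pd 1 r z) ^ 2)) /
      (ip (pd 0 r z) (pd 0 r z) * ip (pd 1 r z) (pd 1 r z) - ip (pd 0 r z) (pd 1 r z) ^ 2) := by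
  have hr' := fun i => contDiffOn_pd hΩ i hr
  have cst : ∀ c : R42, ContDiffOn ℝ ∞ (fun _ : E2 => c) Ω := fun c => contDiffOn_const
  have rp : ∀ w ∈ Ω, ∀ i, ip (pd i r w) p = 0 := fun w hw i => by
    have := pd_ip hΩ i hr (cst p) hw
    rw [pd_congr hΩ i (fun y hy => (hF y hy).fp) hw, pd_const, pd_const, ip_zero_right] at this
    linarith
  have rq : ∀ w ∈ Ω, ∀ i, ip (pd i r w) q = 0 := fun w hw i => by
    have := pd_ip hΩ i hr (cst q) hw
    rw [pd_congr hΩ i (fun y hy => (hF y hy).fq) hw, pd_const, pd_const, ip_zero_right] at this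
    linarith
  have rr : ∀ w ∈ Ω, ∀ i, ip (pd i r w) (r w) = 0 := fun w hw i => by
    have := pd_ip hΩ i hr hr hw
    rw [pd_congr hΩ i (fun y hy => (hF y hy).ff) hw, pd_const, ip_comm (r w)] at this
    linarith
  have hperp : ∀ i, IsPerp p q (r z) (n z) (pd i r z) := fun i =>
    ⟨rp z hz i, rq z hz i, rr z hz i, ho z hz i⟩
  have rijp : ∀ i j, ip (pd j (pd i r) z) p = 0 := fun i j => by
    have := pd_ip hΩ j (hr' i) (cst p) hz
    rw [pd_congr hΩ j (fun y hy => rp y hy i) hz, pd_const, pd_const, ip_zero_right] at this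
    linarith
  have rijq : ∀ i j, ip (pd j (pd i r) z) q = 0 := fun i j => by
    have := pd_ip hΩ j (hr' i) (cst q) hz
    rw [pd_congr hΩ j (fun y hy => rq y hy i) hz, pd_const, pd_const, ip_zero_right] at this
    linarith
  have rijr : ∀ i j, ip (pd j (pd i r) z) (r z) = -ip (pd i r z) (pd j r z) := fun i j => by
    have := pd_ip hΩ j (hr' i) hr hz
    rw [pd_congr hΩ j (fun y hy => rr y hy i) hz, pd_const] at this
    linarith
  have rijn : ∀ i j, ip (pd j (pd i r) z) (n z) = -ip (pd i r z) (pd j n z) := fun i j => by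
    have := pd_ip hΩ j (hr' i) hn hz
    rw [pd_congr hΩ j (fun y hy => ho y hy i) hz, pd_const] at this
    linarith
  have c10 : ∀ w ∈ Ω, pd 0 (pd 1 r) w = pd 1 (pd 0 r) w := fun w hw => pd_comm hΩ hr hw 0 1
  have c101 : pd 1 (pd 0 (pd 1 r)) z = pd 1 (pd 1 (pd 0 r)) z := pd_congr hΩ 1 c10 hz
  have c001 : pd 0 (pd 0 (pd 1 r)) z = pd 1 (pd 0 (pd 0 r)) z := by
    rw [pd_congr hΩ 0 c10 hz, pd_comm hΩ (hr' 0) hz 0 1]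
  have hD : ip (pd 0 r z) (pd 0 r z) * ip (pd 1 r z) (pd 1 r z) - ip (pd 0 r z) (pd 1 r z) ^ 2
      ≠ 0 := by
    have := areaForm_mul (hF z hz) (hperp 0) (hperp 1) (hperp 0) (hperp 1)
    rw [ip_comm (pd 1 r z) (pd 0 r z)] at this
    rw [pow_two, ← this]
    exact mul_ne_zero h0 h0
  -- Once mixed partials are ordered, the third derivatives in Brioschi's formula cancel and leave
  -- (r₀₀, r₁₁) - (r₀₁, r₀₁). `g1` and `g2` decompose these two products: the tangential parts match
  -- the first derivatives of the metric, the normal parts give det II, and the parts along the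
  -- position vector give -det I.
  have g1 := gram_eq (hF z hz) (hperp 0) (hperp 1) h0 (rijp 0 0) (rijq 0 0)
    (Q := pd 1 (pd 1 r) z)
  have g2 := gram_eq (hF z hz) (hperp 0) (hperp 1) h0 (rijp 0 1) (rijq 0 1)
    (Q := pd 1 (pd 0 r) z)
  have s01 := ip_pd_comm hΩ hr hn ho hz 0 1
  unfold brioschi
  simp only [pd_pd_ip hΩ _ _ (hr' _) (hr' _) hz, pd_ip hΩ _ (hr' _) (hr' _) hz, c101, c001,
    c10 z hz]
  rw [div_eq_div_iff (pow_ne_zero 2 hD) hD]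
  simp only [rijr, rijn] at g1 g2
  simp only [Matrix.det_fin_three, Matrix.of_apply, Matrix.cons_val', Matrix.cons_val_zero,
    Matrix.cons_val_one, Matrix.cons_val]
  simp only [ip_comm (pd 0 r z) (pd 1 (pd 1 r) z), ip_comm (pd 1 r z) (pd 1 (pd 1 r) z),
    ip_comm (pd 0 r z) (pd 1 (pd 0 r) z), ip_comm (pd 1 r z) (pd 1 (pd 0 r) z),
    ip_comm (pd 0 r z) (pd 0 (pd 0 r) z),
    ip_comm (pd 0 r z) (pd 1 (pd 1 (pd 0 r)) z), ip_comm (pd 1 r z) (pd 1 (pd 0 (pd 0 r)) z)]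
    at g1 g2 ⊢
  rw [← s01]
  linear_combination
    (ip (pd 0 r z) (pd 0 r z) * ip (pd 1 r z) (pd 1 r z) - ip (pd 0 r z) (pd 1 r z) ^ 2) * (g1 - g2)

end Gauss

/-! ### Areas in the pencil spanned by two linear maps -/

section Pencil

variable {p q f t A₀ A₁ B₀ B₁ : R42}

theorem areaForm_smul_add (a b : ℝ) :
    areaForm p q f t (a • A₀ + b • B₀) (a • A₁ + b • B₁) = a ^ 2 * areaForm p q f t A₀ A₁ +
      a * b * (areaForm p q f t A₀ B₁ + areaForm p q f t B₀ A₁) +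
      b ^ 2 * areaForm p q f t B₀ B₁ := by
  simp only [areaForm_add_left, areaForm_add_right, areaForm_smul_left, areaForm_smul_right]
  ring

/-- The discriminant of the characteristic polynomial of a self-adjoint, non-scalar endomorphism is
positive. -/
theorem sq_lt_sq_of_areaForm_ne_zero (hF : IsFrame p q f t) (hA₀ : IsPerp p q f t A₀)
    (hA₁ : IsPerp p q f t A₁) (hB₀ : IsPerp p q f t B₀) (hB₁ : IsPerp p q f t B₁)
    (hs : ip A₀ B₁ = ip A₁ B₀) (hD : areaForm p q f t A₀ A₁ ≠ 0)
    (hDB : areaForm p q f t B₀ B₁ = areaForm p q f t A₀ A₁)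
    (hu : ∀ c : ℝ, ¬ (B₀ = c • A₀ ∧ B₁ = c • A₁)) :
    4 * areaForm p q f t A₀ A₁ ^ 2 <
      (areaForm p q f t A₀ B₁ + areaForm p q f t B₀ A₁) ^ 2 := by
  have e1 := areaForm_mul hF hA₀ hA₁ hA₀ hA₁
  have e2 := areaForm_mul hF hA₀ hA₁ hB₀ hB₁
  have e3 := areaForm_mul hF hA₀ hA₁ hA₀ hB₁
  have e4 := areaForm_mul hF hA₀ hA₁ hB₀ hA₁
  rw [hDB] at e2
  rw [ip_comm A₁ A₀] at e1 e3
  rw [← hs] at e2 e4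
  set D := areaForm p q f t A₀ A₁
  set K := areaForm p q f t A₀ B₁ + areaForm p q f t B₀ A₁ with hK
  set E := ip A₀ A₀
  set F := ip A₀ A₁
  set G := ip A₁ A₁
  set l := ip A₀ B₀
  set m := ip A₀ B₁
  set n := ip A₁ B₁
  have hDK : D * K = E * n + G * l - 2 * F * m := by rw [hK, mul_add, e3, e4]; ring
  have hDp : 0 < D ^ 2 := by positivity
  have hE : 0 < E := by
    by_contra hE
    have := hA₀.eq_zero hF (not_lt.1 hE)
    apply hD
    have h0 := areaForm_smul_left (p := p) (q := q) (f := f) (t := t) (X := A₀) (Y := A₁) 0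
    rwa [zero_smul, zero_mul, ← this] at h0
  -- With first form (E, F, G) and second form (l, m, n), this writes the discriminant as a sum of
  -- squares that vanishes only if the two forms are proportional.
  have id : 4 * D ^ 2 * (E * m - F * l) ^ 2 +
      (E * (E * n - G * l) - 2 * F * (E * m - F * l)) ^ 2 =
        E ^ 2 * D ^ 2 * (K ^ 2 - 4 * D ^ 2) := by
    have h1 : D ^ 2 * K ^ 2 = (E * n + G * l - 2 * F * m) ^ 2 := by rw [← hDK]; ring
    have h2 : D ^ 2 * D ^ 2 = (E * G - F * F) * (l * n - m * m) := by rw [← e1, ← e2]; ring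
    have h3 : D ^ 2 = E * G - F * F := by rw [← e1]; ring
    linear_combination 4 * (E * m - F * l) ^ 2 * h3 - E ^ 2 * h1 + 4 * E ^ 2 * h2
  by_contra hlt
  have hle : E ^ 2 * D ^ 2 * (K ^ 2 - 4 * D ^ 2) ≤ 0 :=
    mul_nonpos_of_nonneg_of_nonpos (by positivity) (by linarith)
  have i1 : 0 ≤ 4 * D ^ 2 * (E * m - F * l) ^ 2 := by positivity
  have i2 := sq_nonneg (E * (E * n - G * l) - 2 * F * (E * m - F * l))
  have z1 : E * m - F * l = 0 := by
    have : 4 * D ^ 2 * (E * m - F * l) ^ 2 = 0 := by linarith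
    simpa [hD] using this
  have z2 : E * n - G * l = 0 := by
    have : (E * (E * n - G * l) - 2 * F * (E * m - F * l)) ^ 2 = 0 := by linarith
    rw [z1] at this
    simpa [hE.ne'] using this
  have k1 : m = l / E * F := by field_simp; linarith
  have k2 : n = l / E * G := by field_simp; linarith
  have k0 : l = l / E * E := by field_simp
  -- The forms are proportional with factor l / E, so B₀ - (l / E) A₀ and B₁ - (l / E) A₁ are
  -- orthogonal to A₀ and A₁ and vanish.
  refine hu (l / E) ⟨?_, ?_⟩
  · rw [← sub_eq_zero, sub_eq_add_neg, ← neg_smul]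
    refine eq_zero_of_isPerp hD (hB₀.add (hA₀.smul _)) ?_ ?_
    · rw [ip_add_left, ip_smul_left, ip_comm B₀ A₀]
      linarith
    · rw [ip_add_left, ip_smul_left, ip_comm B₀ A₁, ← hs]
      linarith
  · rw [← sub_eq_zero, sub_eq_add_neg, ← neg_smul]
    refine eq_zero_of_isPerp hD (hB₁.add (hA₁.smul _)) ?_ ?_
    · rw [ip_add_left, ip_smul_left, ip_comm B₁ A₀, ip_comm A₁ A₀]
      linarith
    · rw [ip_add_left, ip_smul_left, ip_comm B₁ A₁]
      linarith

/-- The discriminant is positive as soon as some member of the hyperbolic pencil is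
nondegenerate. -/
theorem sq_lt_sq_of_not_umbilic (hF : IsFrame p q f t) (hA₀ : IsPerp p q f t A₀)
    (hA₁ : IsPerp p q f t A₁) (hB₀ : IsPerp p q f t B₀) (hB₁ : IsPerp p q f t B₁)
    (hs : ip A₀ B₁ = ip A₁ B₀) {a b : ℝ} (hab : a ^ 2 - b ^ 2 = 1)
    (hD : areaForm p q f t (a • A₀ + b • B₀) (a • A₁ + b • B₁) ≠ 0)
    (hDB : areaForm p q f t B₀ B₁ = areaForm p q f t A₀ A₁)
    (hu : ∀ c d : ℝ, (c, d) ≠ (0, 0) → ¬ (c • B₀ + d • A₀ = 0 ∧ c • B₁ + d • A₁ = 0)) :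
    4 * areaForm p q f t A₀ A₁ ^ 2 <
      (areaForm p q f t A₀ B₁ + areaForm p q f t B₀ A₁) ^ 2 := by
  -- The pair (A, B) may be degenerate, so it is replaced by the hyperbolically rotated pair (aA +
  -- bB, bA + aB), whose first member is not. The areas of its members stay equal, and the
  -- discriminant is multiplied by (a² - b²)² = 1.
  have key := sq_lt_sq_of_areaForm_ne_zero hF ((hA₀.smul a).add (hB₀.smul b))
    ((hA₁.smul a).add (hB₁.smul b)) ((hA₀.smul b).add (hB₀.smul a))
    ((hA₁.smul b).add (hB₁.smul a)) (by
      simp only [ip_add_left, ip_add_right, ip_smul_left, ip_smul_right, hs, ip_comm B₀ A₁,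
        ip_comm A₁ A₀, ip_comm B₁ A₀, ip_comm B₁ B₀]) hD
    (by rw [areaForm_smul_add, areaForm_smul_add, hDB]; ring) (by
      rintro c ⟨h0, h1⟩
      refine hu (a - c * b) (b - c * a) (fun h => ?_) ⟨?_, ?_⟩
      · simp only [Prod.mk.injEq] at h
        have e1 : a = c * b := by linarith [h.1]
        have e2 : b = c * a := by linarith [h.2]
        have : a ^ 2 - b ^ 2 = 0 := by
          linear_combination a * e1 - b * e2
        linarith
      · rw [← sub_eq_zero] at h0
        rw [← h0]
        module
      · rw [← sub_eq_zero] at h1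
        rw [← h1]
        module)
  simp only [areaForm_add_left, areaForm_add_right, areaForm_smul_left, areaForm_smul_right,
    hDB] at key
  set D := areaForm p q f t A₀ A₁
  set H := areaForm p q f t A₀ B₁
  set H' := areaForm p q f t B₀ A₁
  have h4 : (a ^ 2 - b ^ 2) ^ 2 * (4 * D ^ 2 - (H + H') ^ 2) < 0 := by
    ring_nf at key ⊢
    linarith
  rw [hab] at h4
  linarith

variable {L : E2 →L[ℝ] R42}

theorem eq_coord_smul (X : E2) :
    X = X 0 • EuclideanSpace.single 0 (1 : ℝ) + X 1 • EuclideanSpace.single 1 (1 : ℝ) := by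
  ext i
  fin_cases i <;> simp

theorem areaForm_map (L : E2 →L[ℝ] R42) (X Y : E2) :
    areaForm p q f t (L X) (L Y) = (X 0 * Y 1 - X 1 * Y 0) *
      areaForm p q f t (L (EuclideanSpace.single 0 1)) (L (EuclideanSpace.single 1 1)) := by
  conv_lhs => rw [eq_coord_smul X, eq_coord_smul Y]
  simp only [map_add, map_smul, areaForm_add_left, areaForm_add_right, areaForm_smul_left,
    areaForm_smul_right, areaForm_self]
  rw [areaForm_swap (X := L (EuclideanSpace.single 0 1)) (Y := L (EuclideanSpace.single 1 1))]
  ring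

theorem injective_of_areaForm_ne_zero
    (h : areaForm p q f t (L (EuclideanSpace.single 0 1)) (L (EuclideanSpace.single 1 1)) ≠ 0) :
    Function.Injective L := by
  refine (injective_iff_map_eq_zero L).2 fun X hX => ?_
  have h0 : ∀ Y, areaForm p q f t (0 : R42) Y = 0 := fun Y => by
    simpa using areaForm_smul_left (p := p) (q := q) (f := f) (t := t) (X := 0) (Y := Y) 0
  have e0 := areaForm_map (p := p) (q := q) (f := f) (t := t) L X (EuclideanSpace.single 0 1)
  have e1 := areaForm_map (p := p) (q := q) (f := f) (t := t) L X (EuclideanSpace.single 1 1)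
  rw [hX, h0] at e0 e1
  simp [h] at e0 e1
  ext i
  fin_cases i <;> simp [e0, e1]

theorem areaForm_ne_zero_of_injective (hF : IsFrame p q f t) (hL : ∀ X, IsPerp p q f t (L X))
    (hi : Function.Injective L) :
    areaForm p q f t (L (EuclideanSpace.single 0 1)) (L (EuclideanSpace.single 1 1)) ≠ 0 := by
  intro h
  obtain ⟨a, b, hab, h0⟩ := exists_smul_add_eq_zero hF (hL _) (hL _) h
  rw [← map_smul, ← map_smul, ← map_add] at h0
  have := (injective_iff_map_eq_zero L).1 hi _ h0
  have e0 := congrArg (fun X : E2 => X 0) this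
  have e1 := congrArg (fun X : E2 => X 1) this
  simp at e0 e1
  exact hab (by rw [e0, e1])

theorem exists_ker_of_areaForm_eq_zero (hF : IsFrame p q f t) (hL : ∀ X, IsPerp p q f t (L X))
    (h : areaForm p q f t (L (EuclideanSpace.single 0 1)) (L (EuclideanSpace.single 1 1)) = 0) :
    ∃ X, X ≠ 0 ∧ L X = 0 := by
  by_contra! hc
  refine areaForm_ne_zero_of_injective hF hL ((injective_iff_map_eq_zero L).2 fun X hX => ?_) h
  by_contra h0
  exact hc X h0 hX

end Pencil

/-! ### The hyperbolic angle of the curvature directions -/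

section Angle

/-- The hyperbolic angle `x` with `D cosh 2x + H sinh 2x = 0`. -/
noncomputable def hypAngle (D H : ℝ) : ℝ := Real.log ((H - D) / (H + D)) / 4

theorem div_pos_of_sq_lt_sq {D H : ℝ} (h : D ^ 2 < H ^ 2) : 0 < (H - D) / (H + D) := by
  have h1 : 0 < (H - D) * (H + D) := by linarith [sq_sub_sq H D, mul_comm (H - D) (H + D)]
  rcases pos_and_pos_or_neg_and_neg_of_mul_pos h1 with ⟨a, b⟩ | ⟨a, b⟩
  · exact div_pos a b
  · exact div_pos_of_neg_of_neg a b

/-- In exponentials the equation is linear in `exp (4 * x)`, with positive solution (H - D) / (H +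
D). Existence yields the curvature directions; uniqueness makes the angle independent of the chart.
-/
theorem hypAngle_iff {D H : ℝ} (h : D ^ 2 < H ^ 2) (x : ℝ) :
    D * (Real.cosh x ^ 2 + Real.sinh x ^ 2) + 2 * H * (Real.cosh x * Real.sinh x) = 0 ↔
      x = hypAngle D H := by
  have hp := div_pos_of_sq_lt_sq h
  have hne : H + D ≠ 0 := fun e => by rw [e, div_zero] at hp; exact lt_irrefl _ hp
  have e1 : D * (Real.cosh x ^ 2 + Real.sinh x ^ 2) + 2 * H * (Real.cosh x * Real.sinh x) =
      ((H + D) * Real.exp (4 * x) - (H - D)) / (2 * Real.exp (2 * x)) := by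
    have h2 : Real.exp (2 * x) = Real.exp x ^ 2 := by rw [← Real.exp_nat_mul]; norm_num
    have h4 : Real.exp (4 * x) = Real.exp x ^ 4 := by rw [← Real.exp_nat_mul]; norm_num
    rw [Real.cosh_eq, Real.sinh_eq, h2, h4, Real.exp_neg]
    have := Real.exp_pos x
    field_simp
    ring
  rw [e1, div_eq_zero_iff, or_iff_left (by positivity), sub_eq_zero, hypAngle]
  have e2 : (H + D) * Real.exp (4 * x) = H - D ↔ Real.exp (4 * x) = (H - D) / (H + D) := by
    rw [eq_div_iff hne, mul_comm]
  rw [e2]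
  constructor
  · intro e
    rw [← e, Real.log_exp]
    ring
  · intro e
    rw [e, mul_div_cancel₀ _ (by norm_num : (4 : ℝ) ≠ 0), Real.exp_log hp]

end Angle

/-! ### Product rules for differentials -/

section Rules

variable {M : Type*} [TopologicalSpace M] [ChartedSpace E2 M]
variable {F : Type*} [NormedAddCommGroup F] [NormedSpace ℝ F]

theorem ContMDiff.ip {g h : M → R42} (hg : ContMDiff 𝓘(ℝ, E2) 𝓘(ℝ, R42) ∞ g)
    (hh : ContMDiff 𝓘(ℝ, E2) 𝓘(ℝ, R42) ∞ h) :
    ContMDiff 𝓘(ℝ, E2) 𝓘(ℝ, ℝ) ∞ fun x => ip (g x) (h x) :=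
  ipBilin.isBoundedBilinearMap.contDiff.contMDiff.comp (hg.prodMk_space hh)

theorem vdiff_add {g h : M → F} (hg : ContMDiff 𝓘(ℝ, E2) 𝓘(ℝ, F) ∞ g)
    (hh : ContMDiff 𝓘(ℝ, E2) 𝓘(ℝ, F) ∞ h) (x : M) (X : E2) :
    vdiff (fun y => g y + h y) x X = (vdiff g x X : F) + vdiff h x X := by
  have dg := hg.mdifferentiableAt (x := x) (by simp)
  have dh := hh.mdifferentiableAt (x := x) (by simp)
  have := ((differentiableAt_comp_symm dg).hasFDerivAt.add
    (differentiableAt_comp_symm dh).hasFDerivAt).fderiv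
  rw [vdiff_apply dg, vdiff_apply dh]
  exact (vdiff_apply ((hg.add hh).mdifferentiableAt (by simp)) X).trans
    (congrArg (fun L : E2 →L[ℝ] F => L X) this)

theorem vdiff_const (c : F) (x : M) (X : E2) : (vdiff (fun _ : M => c) x X : F) = 0 := by
  rw [vdiff_apply mdifferentiableAt_const]
  simp [Function.comp_def]

theorem vdiff_smul {a : M → ℝ} {g : M → F} (ha : ContMDiff 𝓘(ℝ, E2) 𝓘(ℝ, ℝ) ∞ a)
    (hg : ContMDiff 𝓘(ℝ, E2) 𝓘(ℝ, F) ∞ g) (x : M) (X : E2) :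
    vdiff (fun y => a y • g y) x X =
      a x • (vdiff g x X : F) + (vdiff a x X : ℝ) • g x := by
  have da := ha.mdifferentiableAt (x := x) (by simp)
  have dg := hg.mdifferentiableAt (x := x) (by simp)
  have := ((differentiableAt_comp_symm da).hasFDerivAt.smul
    (differentiableAt_comp_symm dg).hasFDerivAt).fderiv
  rw [vdiff_apply dg, vdiff_apply da]
  refine (vdiff_apply ((ha.smul hg).mdifferentiableAt (by simp)) X).trans
    ((congrArg (fun L : E2 →L[ℝ] F => L X) this).trans ?_)
  simp

theorem contMDiff_const_smul (a : ℝ) {g : M → F} (hg : ContMDiff 𝓘(ℝ, E2) 𝓘(ℝ, F) ∞ g) :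
    ContMDiff 𝓘(ℝ, E2) 𝓘(ℝ, F) ∞ fun y => a • g y :=
  (contDiff_const_smul a).contMDiff.comp hg

theorem vdiff_const_smul (a : ℝ) {g : M → F} (hg : ContMDiff 𝓘(ℝ, E2) 𝓘(ℝ, F) ∞ g) (x : M)
    (X : E2) : vdiff (fun y => a • g y) x X = a • (vdiff g x X : F) := by
  have h := vdiff_smul (contMDiff_const (c := a)) hg x X
  rw [vdiff_const, zero_smul, add_zero] at h
  exact h

theorem vdiff_ip {g h : M → R42} (hg : ContMDiff 𝓘(ℝ, E2) 𝓘(ℝ, R42) ∞ g)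
    (hh : ContMDiff 𝓘(ℝ, E2) 𝓘(ℝ, R42) ∞ h) (x : M) (X : E2) :
    (vdiff (fun y => ip (g y) (h y)) x X : ℝ) =
      ip (vdiff g x X) (h x) + ip (g x) (vdiff h x X) := by
  have dg := hg.mdifferentiableAt (x := x) (by simp)
  have dh := hh.mdifferentiableAt (x := x) (by simp)
  have := (hasFDerivAt_ip (differentiableAt_comp_symm dg).hasFDerivAt
    (differentiableAt_comp_symm dh).hasFDerivAt).fderiv
  rw [vdiff_apply ((hg.ip hh).mdifferentiableAt (by simp)), vdiff_apply dg, vdiff_apply dh]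
  have := congrArg (fun L : E2 →L[ℝ] ℝ => L X) this
  simp at this
  rw [add_comm]
  exact this

theorem ip_vdiff_of_const {g h : M → R42} (hg : ContMDiff 𝓘(ℝ, E2) 𝓘(ℝ, R42) ∞ g)
    (hh : ContMDiff 𝓘(ℝ, E2) 𝓘(ℝ, R42) ∞ h) {c : ℝ} (hc : ∀ x, ip (g x) (h x) = c) (x : M)
    (X : E2) : ip (vdiff g x X) (h x) + ip (g x) (vdiff h x X) = 0 := by
  rw [← vdiff_ip hg hh, funext hc, vdiff_const]

/-- The derivative of a field of vectors moved by a field of linear maps. -/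
theorem vdiff_clm_apply {T : M → R42 →L[ℝ] R42} {g : M → R42}
    (hT : ContMDiff 𝓘(ℝ, E2) 𝓘(ℝ, R42 →L[ℝ] R42) ∞ T)
    (hg : ContMDiff 𝓘(ℝ, E2) 𝓘(ℝ, R42) ∞ g) (x : M) (X : E2) :
    (vdiff (fun y => T y (g y)) x X : R42) =
      T x (vdiff g x X) + (vdiff T x X : R42 →L[ℝ] R42) (g x) := by
  have dT := hT.mdifferentiableAt (x := x) (by simp)
  have dg := hg.mdifferentiableAt (x := x) (by simp)
  have := ((differentiableAt_comp_symm dT).hasFDerivAt.clm_apply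
    (differentiableAt_comp_symm dg).hasFDerivAt).fderiv
  rw [vdiff_apply dg, vdiff_apply dT]
  refine (vdiff_apply ((hT.clm_apply hg).mdifferentiableAt (by simp)) X).trans
    ((congrArg (fun L : E2 →L[ℝ] R42 => L X) this).trans ?_)
  simp

end Rules

/-! ### Surfaces with unit normal and their parallel surfaces -/

section Front

variable {M : Type*} [TopologicalSpace M] [ChartedSpace E2 M]

/-- A smooth surface in hyperbolic space, possibly with singularities, with a unit normal field. -/
structure IsNormalPair (p q : R42) (f t : M → R42) : Prop where
  smooth_f : ContMDiff 𝓘(ℝ, E2) 𝓘(ℝ, R42) ∞ f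
  smooth_t : ContMDiff 𝓘(ℝ, E2) 𝓘(ℝ, R42) ∞ t
  frame : ∀ x, IsFrame p q (f x) (t x)
  orth : ∀ (x : M) (X : E2), ip (vdiff f x X) (t x) = 0

variable {p q : R42} {f t : M → R42}

theorem IsFlatFront.isNormalPair (hpq : IsOrthonormalPair p q) (h : IsFlatFront p q f t) :
    IsNormalPair p q f t := by
  obtain ⟨o, -, -, -, hf⟩ := h.mem_hyperbolicSpace
  exact ⟨h.smooth_f, h.smooth_t, fun x => ⟨hpq.1, hpq.2.1, (hf x).2.2.1, h.normal_unit x, hpq.2.2,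
    (hf x).1, (hf x).2.1, (h.normal_mem x).1, (h.normal_mem x).2, h.normal_tangent x⟩,
    h.normal_orth⟩

theorem contMDiff_parallelFront (hf : ContMDiff 𝓘(ℝ, E2) 𝓘(ℝ, R42) ∞ f)
    (ht : ContMDiff 𝓘(ℝ, E2) 𝓘(ℝ, R42) ∞ t) (δ : ℝ) :
    ContMDiff 𝓘(ℝ, E2) 𝓘(ℝ, R42) ∞ (parallelFront f t δ) :=
  (contMDiff_const_smul _ hf).add (contMDiff_const_smul _ ht)

theorem vdiff_parallelFront (hf : ContMDiff 𝓘(ℝ, E2) 𝓘(ℝ, R42) ∞ f)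
    (ht : ContMDiff 𝓘(ℝ, E2) 𝓘(ℝ, R42) ∞ t) (δ : ℝ) (x : M) (X : E2) :
    vdiff (parallelFront f t δ) x X =
      Real.cosh δ • (vdiff f x X : R42) + Real.sinh δ • (vdiff t x X : R42) := by
  have := vdiff_add (contMDiff_const_smul (Real.cosh δ) hf) (contMDiff_const_smul (Real.sinh δ) ht)
    x X
  rw [vdiff_const_smul _ hf, vdiff_const_smul _ ht] at this
  exact this

/-- The unit normal field of the parallel surface. -/
noncomputable def parallelNormal (f t : M → R42) (δ : ℝ) (x : M) : R42 :=
  Real.sinh δ • f x + Real.cosh δ • t x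

theorem contMDiff_parallelNormal (hf : ContMDiff 𝓘(ℝ, E2) 𝓘(ℝ, R42) ∞ f)
    (ht : ContMDiff 𝓘(ℝ, E2) 𝓘(ℝ, R42) ∞ t) (δ : ℝ) :
    ContMDiff 𝓘(ℝ, E2) 𝓘(ℝ, R42) ∞ (parallelNormal f t δ) :=
  (contMDiff_const_smul _ hf).add (contMDiff_const_smul _ ht)

theorem vdiff_parallelNormal (hf : ContMDiff 𝓘(ℝ, E2) 𝓘(ℝ, R42) ∞ f)
    (ht : ContMDiff 𝓘(ℝ, E2) 𝓘(ℝ, R42) ∞ t) (δ : ℝ) (x : M) (X : E2) :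
    vdiff (parallelNormal f t δ) x X =
      Real.sinh δ • (vdiff f x X : R42) + Real.cosh δ • (vdiff t x X : R42) := by
  have := vdiff_add (contMDiff_const_smul (Real.sinh δ) hf) (contMDiff_const_smul (Real.cosh δ) ht)
    x X
  rw [vdiff_const_smul _ hf, vdiff_const_smul _ ht] at this
  exact this

namespace IsNormalPair

theorem perp_f (h : IsNormalPair p q f t) (x : M) (X : E2) :
    IsPerp p q (f x) (t x) (vdiff f x X) := by
  refine ⟨?_, ?_, ?_, h.orth x X⟩
  · have := ip_vdiff_of_const h.smooth_f (contMDiff_const (c := p)) (fun x => (h.frame x).fp) x X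
    rwa [vdiff_const, ip_zero_right, add_zero] at this
  · have := ip_vdiff_of_const h.smooth_f (contMDiff_const (c := q)) (fun x => (h.frame x).fq) x X
    rwa [vdiff_const, ip_zero_right, add_zero] at this
  · have := ip_vdiff_of_const h.smooth_f h.smooth_f (fun x => (h.frame x).ff) x X
    rw [ip_comm (f x)] at this
    linarith

theorem perp_t (h : IsNormalPair p q f t) (x : M) (X : E2) :
    IsPerp p q (f x) (t x) (vdiff t x X) := by
  refine ⟨?_, ?_, ?_, ?_⟩
  · have := ip_vdiff_of_const h.smooth_t (contMDiff_const (c := p)) (fun x => (h.frame x).tp) x X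
    rwa [vdiff_const, ip_zero_right, add_zero] at this
  · have := ip_vdiff_of_const h.smooth_t (contMDiff_const (c := q)) (fun x => (h.frame x).tq) x X
    rwa [vdiff_const, ip_zero_right, add_zero] at this
  · have := ip_vdiff_of_const h.smooth_t h.smooth_f (fun x => (h.frame x).tf) x X
    rwa [ip_comm (t x), h.orth, add_zero] at this
  · have := ip_vdiff_of_const h.smooth_t h.smooth_t (fun x => (h.frame x).tt) x X
    rw [ip_comm (t x)] at this
    linarith

/-- Passing to a parallel surface is a hyperbolic rotation in the plane of 𝔣 and 𝔱, whose signature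
is (1, 1). -/
theorem parallel (h : IsNormalPair p q f t) (δ : ℝ) :
    IsNormalPair p q (parallelFront f t δ) (parallelNormal f t δ) := by
  have c := Real.cosh_sq δ
  refine ⟨contMDiff_parallelFront h.smooth_f h.smooth_t δ,
    contMDiff_parallelNormal h.smooth_f h.smooth_t δ, fun x => ?_, fun x X => ?_⟩
  · have := h.frame x
    refine ⟨this.pp, this.qq, ?_, ?_, this.pq, ?_, ?_, ?_, ?_, ?_⟩ <;>
      simp only [parallelFront, parallelNormal, ip_add_left, ip_add_right, ip_smul_left,
        ip_smul_right, this.ff, this.tt, this.fp, this.fq, this.tp, this.tq, this.tf,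
        ip_comm (f x) (t x)] <;> linarith
  · have a := h.perp_f x X
    have b := h.perp_t x X
    rw [vdiff_parallelFront h.smooth_f h.smooth_t]
    simp only [parallelNormal, ip_add_left, ip_add_right, ip_smul_left, ip_smul_right, a.f, a.t,
      b.f, b.t]
    ring

theorem chart_frame (h : IsNormalPair p q f t) (x : M) (z : E2) :
    IsFrame p q ((f ∘ (chartAt E2 x).symm) z) ((t ∘ (chartAt E2 x).symm) z) := h.frame _

variable [IsManifold 𝓘(ℝ, E2) ∞ M]

theorem chart_orth (h : IsNormalPair p q f t) (x : M) {z : E2}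
    (hz : z ∈ (chartAt E2 x).target) (i : Fin 2) :
    ip (pd i (f ∘ (chartAt E2 x).symm) z) ((t ∘ (chartAt E2 x).symm) z) = 0 := by
  rw [pd, fderiv_comp_symm h.smooth_f x hz]
  exact h.orth _ _

theorem ip_vdiff_comm (h : IsNormalPair p q f t) (x : M) :
    ip (vdiff f x (EuclideanSpace.single 0 1 : E2)) (vdiff t x (EuclideanSpace.single 1 1 : E2)) =
      ip (vdiff f x (EuclideanSpace.single 1 1 : E2))
        (vdiff t x (EuclideanSpace.single 0 1 : E2)) := by
  have := ip_pd_comm (chartAt E2 x).open_target (contDiffOn_comp_symm h.smooth_f x)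
    (contDiffOn_comp_symm h.smooth_t x) (fun z hz => h.chart_orth x hz) (mem_chart_target E2 x) 0 1
  simp only [pd] at this
  simpa only [← vdiff_apply (h.smooth_f.mdifferentiableAt (by simp)),
    ← vdiff_apply (h.smooth_t.mdifferentiableAt (by simp))] using this

/-- Flatness of an immersion in terms of its third fundamental form. -/
theorem gaussCurvature_eq_zero_iff (h : IsNormalPair p q f t) {x : M}
    (hi : Function.Injective (vdiff f x)) :
    gaussCurvature f x = 0 ↔
      ip (vdiff f x (EuclideanSpace.single 0 1 : E2)) (vdiff t x (EuclideanSpace.single 0 1 : E2)) *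
      ip (vdiff f x (EuclideanSpace.single 1 1 : E2)) (vdiff t x (EuclideanSpace.single 1 1 : E2)) -
      ip (vdiff f x (EuclideanSpace.single 0 1 : E2)) (vdiff t x (EuclideanSpace.single 1 1 : E2)) *
      ip (vdiff f x (EuclideanSpace.single 1 1 : E2)) (vdiff t x (EuclideanSpace.single 0 1 : E2)) =
      ip (vdiff f x (EuclideanSpace.single 0 1 : E2)) (vdiff f x (EuclideanSpace.single 0 1 : E2)) *
      ip (vdiff f x (EuclideanSpace.single 1 1 : E2)) (vdiff f x (EuclideanSpace.single 1 1 : E2)) -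
      ip (vdiff f x (EuclideanSpace.single 0 1 : E2)) (vdiff f x (EuclideanSpace.single 1 1 : E2)) *
      ip (vdiff f x (EuclideanSpace.single 1 1 : E2))
        (vdiff f x (EuclideanSpace.single 0 1 : E2)) := by
  have h0 := areaForm_ne_zero_of_injective (L := vdiff f x) (h.frame x) (h.perp_f x) hi
  have h1 := areaForm_mul (h.frame x) (h.perp_f x (EuclideanSpace.single 0 1))
    (h.perp_f x (EuclideanSpace.single 1 1)) (h.perp_f x (EuclideanSpace.single 0 1))
    (h.perp_f x (EuclideanSpace.single 1 1))
  have hf : ∀ i, pd i (f ∘ (chartAt E2 x).symm) (chartAt E2 x x) =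
      vdiff f x (EuclideanSpace.single i 1 : E2) := fun i =>
    (vdiff_apply (h.smooth_f.mdifferentiableAt (by simp)) _).symm
  have ht : ∀ i, pd i (t ∘ (chartAt E2 x).symm) (chartAt E2 x x) =
      vdiff t x (EuclideanSpace.single i 1 : E2) := fun i =>
    (vdiff_apply (h.smooth_t.mdifferentiableAt (by simp)) _).symm
  have key := brioschi_eq (chartAt E2 x).open_target (contDiffOn_comp_symm h.smooth_f x)
    (contDiffOn_comp_symm h.smooth_t x) (fun z _ => h.chart_frame x z)
    (fun z hz => h.chart_orth x hz) (mem_chart_target E2 x) (by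
      rw [hf, hf]
      rw [Function.comp_apply, Function.comp_apply,
        (chartAt E2 x).left_inv (mem_chart_source E2 x)]
      exact h0)
  have hK : gaussCurvature f x = _ := key
  rw [hK, div_eq_zero_iff]
  simp only [hf, ht]
  rw [ip_comm (vdiff f x (EuclideanSpace.single 1 1 : E2))
    (vdiff f x (EuclideanSpace.single 0 1 : E2)), ← pow_two] at h1 ⊢
  -- The denominator of the curvature is the squared area of d𝔣, nonzero for an immersion.
  rw [or_iff_left (by rw [pow_two (ip _ _), ← h1]; exact pow_ne_zero 2 h0), sub_eq_zero, pow_two]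

end IsNormalPair

end Front

/-! ### Existence of the angle and of the curvature directions -/

section CurvatureData

theorem eq_zero_of_smul_add_smul {A B : R42} {a b : ℝ} (hab : a ^ 2 - b ^ 2 ≠ 0)
    (h1 : a • A + b • B = 0) (h2 : b • A + a • B = 0) : A = 0 ∧ B = 0 := by
  have hA : (a ^ 2 - b ^ 2) • A = a • (a • A + b • B) - b • (b • A + a • B) := by module
  have hB : (a ^ 2 - b ^ 2) • B = a • (b • A + a • B) - b • (a • A + b • B) := by module
  rw [h1, h2, smul_zero, smul_zero, sub_zero] at hA hB
  exact ⟨(smul_eq_zero.1 hA).resolve_left hab, (smul_eq_zero.1 hB).resolve_left hab⟩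

variable {M : Type*} [TopologicalSpace M] [ChartedSpace E2 M] {p q : R42} {f t : M → R42}

theorem IsNormalPair.perp_smul_add (h : IsNormalPair p q f t) (a b : ℝ) (x : M) (X : E2) :
    IsPerp p q (f x) (t x) (a • (vdiff f x X : R42) + b • (vdiff t x X : R42)) :=
  ((h.perp_f x X).smul a).add ((h.perp_t x X).smul b)

/-- The linear map `a df + b dt`. -/
noncomputable def pencil (f t : M → R42) (x : M) (a b : ℝ) : E2 →L[ℝ] R42 :=
  a • (vdiff f x : E2 →L[ℝ] R42) + b • (vdiff t x : E2 →L[ℝ] R42)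

theorem pencil_apply (x : M) (a b : ℝ) (X : E2) :
    pencil f t x a b X = a • (vdiff f x X : R42) + b • (vdiff t x X : R42) := rfl

theorem areaForm_pencil (x : M) (a b : ℝ) (X Y : E2) :
    areaForm p q (f x) (t x) (pencil f t x a b X) (pencil f t x a b Y) =
      a ^ 2 * areaForm p q (f x) (t x) (vdiff f x X) (vdiff f x Y) +
      a * b * (areaForm p q (f x) (t x) (vdiff f x X) (vdiff t x Y) +
        areaForm p q (f x) (t x) (vdiff t x X) (vdiff f x Y)) +
      b ^ 2 * areaForm p q (f x) (t x) (vdiff t x X) (vdiff t x Y) :=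
  areaForm_smul_add a b

variable [IsManifold 𝓘(ℝ, E2) ∞ M]

/-- 𝔣 may be singular at `x`, so the Gauss equation is applied to a regular parallel surface. There
det II = det I, and the common factor, the area of the parallel surface, cancels. The difference of
the remaining two areas is multiplied by cosh² δ - sinh² δ = 1 under the rotation, so the equality
holds for d𝔣 and d𝔱 as well. -/
theorem IsFlatFront.areaForm_pencil_ne_zero (hpq : IsOrthonormalPair p q)
    (h : IsFlatFront p q f t) (x : M) : ∃ δ : ℝ,
      areaForm p q (f x) (t x)
        (pencil f t x (Real.cosh δ) (Real.sinh δ) (EuclideanSpace.single 0 1))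
        (pencil f t x (Real.cosh δ) (Real.sinh δ) (EuclideanSpace.single 1 1)) ≠ 0 ∧
      areaForm p q (f x) (t x) (vdiff t x (EuclideanSpace.single 0 1 : E2))
        (vdiff t x (EuclideanSpace.single 1 1 : E2)) =
      areaForm p q (f x) (t x) (vdiff f x (EuclideanSpace.single 0 1 : E2))
        (vdiff f x (EuclideanSpace.single 1 1 : E2)) := by
  have N := h.isNormalPair hpq
  obtain ⟨δ, hδ⟩ := h.flat x
  obtain ⟨hi, hK⟩ := hδ.self_of_nhds
  have hK' := ((N.parallel δ).gaussCurvature_eq_zero_iff hi).1 hK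
  have hi' : Function.Injective (pencil f t x (Real.cosh δ) (Real.sinh δ)) := by
    intro X Y hXY
    apply hi
    rw [pencil_apply, pencil_apply, ← vdiff_parallelFront N.smooth_f N.smooth_t,
      ← vdiff_parallelFront N.smooth_f N.smooth_t] at hXY
    exact hXY
  have h0 := areaForm_ne_zero_of_injective (N.frame x) (fun X => N.perp_smul_add _ _ x X) hi'
  refine ⟨δ, h0, ?_⟩
  simp only [vdiff_parallelFront N.smooth_f N.smooth_t,
    vdiff_parallelNormal N.smooth_f N.smooth_t] at hK'
  rw [← areaForm_mul (N.frame x) (N.perp_smul_add _ _ x _) (N.perp_smul_add _ _ x _)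
    (N.perp_smul_add _ _ x _) (N.perp_smul_add _ _ x _), ← areaForm_mul (N.frame x)
    (N.perp_smul_add _ _ x _) (N.perp_smul_add _ _ x _) (N.perp_smul_add _ _ x _)
    (N.perp_smul_add _ _ x _)] at hK'
  have e := mul_left_cancel₀ h0 hK'
  rw [areaForm_smul_add, areaForm_smul_add] at e
  have c := Real.cosh_sq δ
  linear_combination e + (areaForm p q (f x) (t x) (vdiff f x (EuclideanSpace.single 0 1 : E2))
    (vdiff f x (EuclideanSpace.single 1 1 : E2)) - areaForm p q (f x) (t x)
    (vdiff t x (EuclideanSpace.single 0 1 : E2)) (vdiff t x (EuclideanSpace.single 1 1 : E2))) * c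

theorem IsFlatFront.areaForm_eq (hpq : IsOrthonormalPair p q) (h : IsFlatFront p q f t) (x : M)
    (X Y : E2) : areaForm p q (f x) (t x) (vdiff t x X) (vdiff t x Y) =
      areaForm p q (f x) (t x) (vdiff f x X) (vdiff f x Y) := by
  obtain ⟨δ, -, e⟩ := h.areaForm_pencil_ne_zero hpq x
  have e1 := areaForm_map (p := p) (q := q) (f := f x) (t := t x) (vdiff t x) X Y
  have e2 := areaForm_map (p := p) (q := q) (f := f x) (t := t x) (vdiff f x) X Y
  exact e1.trans ((congrArg _ e).trans e2.symm)

/-- The area density `⋆(df ∧ df) / 2`. -/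
noncomputable def areaFst (p q : R42) (f t : M → R42) (x : M) : ℝ :=
  areaForm p q (f x) (t x) (vdiff f x (EuclideanSpace.single 0 1 : E2))
    (vdiff f x (EuclideanSpace.single 1 1 : E2))

/-- The mixed area density `⋆(df ∧ dt) / 2`. -/
noncomputable def areaMix (p q : R42) (f t : M → R42) (x : M) : ℝ :=
  (areaForm p q (f x) (t x) (vdiff f x (EuclideanSpace.single 0 1 : E2))
    (vdiff t x (EuclideanSpace.single 1 1 : E2)) +
  areaForm p q (f x) (t x) (vdiff t x (EuclideanSpace.single 0 1 : E2))
    (vdiff f x (EuclideanSpace.single 1 1 : E2))) / 2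

theorem IsFlatFront.areaForm_pencil (hpq : IsOrthonormalPair p q) (h : IsFlatFront p q f t) (x : M)
    (a b : ℝ) :
    areaForm p q (f x) (t x) (pencil f t x a b (EuclideanSpace.single 0 1))
      (pencil f t x a b (EuclideanSpace.single 1 1)) =
    (a ^ 2 + b ^ 2) * areaFst p q f t x + 2 * (a * b) * areaMix p q f t x := by
  rw [_root_.areaForm_pencil, h.areaForm_eq hpq, areaFst, areaMix]
  ring

/-- This inequality is what makes the angle exist; the half in `areaMix` absorbs the 4 of the
discriminant. -/
theorem IsFlatFront.areaFst_sq_lt (hpq : IsOrthonormalPair p q) (h : IsFlatFront p q f t)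
    (humb : ∀ x, ¬ IsUmbilic f t x) (x : M) : areaFst p q f t x ^ 2 < areaMix p q f t x ^ 2 := by
  have N := h.isNormalPair hpq
  obtain ⟨δ, h0, e⟩ := h.areaForm_pencil_ne_zero hpq x
  have := sq_lt_sq_of_not_umbilic (N.frame x) (N.perp_f x _) (N.perp_f x _) (N.perp_t x _)
    (N.perp_t x _) (N.ip_vdiff_comm x) (Real.cosh_sq_sub_sinh_sq δ) h0 e (by
      rintro c d hcd ⟨h0, h1⟩
      refine humb x ⟨c, d, hcd, fun X => ?_⟩
      have hX : pencil f t x d c X = 0 := by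
        rw [eq_coord_smul X, map_add, map_smul, map_smul, pencil_apply, pencil_apply,
          add_comm (d • _), h0, add_comm (d • _), h1, smul_zero, smul_zero, add_zero]
      exact (add_comm _ _).trans hX)
  rw [areaMix, div_pow, areaFst]
  linarith

/-- The parallel distance at which a flat front becomes singular. -/
noncomputable def frontAngle (p q : R42) (f t : M → R42) (x : M) : ℝ :=
  hypAngle (areaFst p q f t x) (areaMix p q f t x)

theorem IsFlatFront.areaForm_frontAngle (hpq : IsOrthonormalPair p q) (h : IsFlatFront p q f t)
    (humb : ∀ x, ¬ IsUmbilic f t x) (x : M) :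
    areaFst p q f t x * (Real.cosh (frontAngle p q f t x) ^ 2 +
      Real.sinh (frontAngle p q f t x) ^ 2) + 2 * areaMix p q f t x *
      (Real.cosh (frontAngle p q f t x) * Real.sinh (frontAngle p q f t x)) = 0 :=
  (hypAngle_iff (h.areaFst_sq_lt hpq humb x) _).2 rfl

theorem ContDiffOn.areaForm {E : Type*} [NormedAddCommGroup E] [NormedSpace ℝ E] {s : Set E}
    {f t X Y : E → R42} (hf : ContDiffOn ℝ ∞ f s) (ht : ContDiffOn ℝ ∞ t s)
    (hX : ContDiffOn ℝ ∞ X s) (hY : ContDiffOn ℝ ∞ Y s) :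
    ContDiffOn ℝ ∞ (fun z => areaForm p q (f z) (t z) (X z) (Y z)) s := by
  have hM : ∀ i j : Fin 6, ContDiffOn ℝ ∞ (fun z =>
      Matrix.of ![p, q, f z, t z, X z, Y z] i j) s := by
    intro i j
    fin_cases i
    · exact contDiffOn_const
    · exact contDiffOn_const
    · exact contDiffOn_pi.1 hf j
    · exact contDiffOn_pi.1 ht j
    · exact contDiffOn_pi.1 hX j
    · exact contDiffOn_pi.1 hY j
  simp only [_root_.areaForm, Matrix.det_apply']
  exact ContDiffOn.sum fun σ _ => contDiffOn_const.mul (contDiffOn_prod fun i _ => hM _ _)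

theorem contDiffAt_hypAngle {E : Type*} [NormedAddCommGroup E] [NormedSpace ℝ E] {D H : E → ℝ}
    {z : E} (hD : ContDiffAt ℝ ∞ D z) (hH : ContDiffAt ℝ ∞ H z) (h : D z ^ 2 < H z ^ 2) :
    ContDiffAt ℝ ∞ (fun w => hypAngle (D w) (H w)) z := by
  have hp := div_pos_of_sq_lt_sq h
  have hne : H z + D z ≠ 0 := fun e => by rw [e, div_zero] at hp; exact lt_irrefl _ hp
  exact (((hH.sub hD).div (hH.add hD) hne).log hp.ne').div_const 4

/-- The densities `areaFst` and `areaMix` are computed in a chart that varies with the point, so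
their smoothness is not available. In a fixed chart both are multiplied by the same Jacobian
determinant, which does not move the root. -/
theorem IsFlatFront.contMDiff_frontAngle (hpq : IsOrthonormalPair p q) (h : IsFlatFront p q f t)
    (humb : ∀ x, ¬ IsUmbilic f t x) :
    ContMDiff 𝓘(ℝ, E2) 𝓘(ℝ, ℝ) ∞ (frontAngle p q f t) := by
  intro x
  have N := h.isNormalPair hpq
  set e := chartAt E2 x with he
  set r := f ∘ e.symm with hr
  set n := t ∘ e.symm with hn
  have sr : ContDiffOn ℝ ∞ r e.target := contDiffOn_comp_symm N.smooth_f x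
  have sn : ContDiffOn ℝ ∞ n e.target := contDiffOn_comp_symm N.smooth_t x
  have sr' := fun i => contDiffOn_pd e.open_target i sr
  have sn' := fun i => contDiffOn_pd e.open_target i sn
  set D : E2 → ℝ := fun z => areaForm p q (r z) (n z) (pd 0 r z) (pd 1 r z) with hD
  set H : E2 → ℝ := fun z => (areaForm p q (r z) (n z) (pd 0 r z) (pd 1 n z) +
    areaForm p q (r z) (n z) (pd 0 n z) (pd 1 r z)) / 2 with hH
  have sD : ContDiffOn ℝ ∞ D e.target := sr.areaForm sn (sr' 0) (sr' 1)
  have sH : ContDiffOn ℝ ∞ H e.target :=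
    ((sr.areaForm sn (sr' 0) (sn' 1)).add (sr.areaForm sn (sn' 0) (sr' 1))).div_const 2
  have hx := mem_chart_source E2 x
  have hmem : e.target ∈ 𝓝 (e x) := e.open_target.mem_nhds (mem_chart_target E2 x)
  have h0 : D (e x) ^ 2 < H (e x) ^ 2 := by
    have := h.areaFst_sq_lt hpq humb x
    rw [areaFst, areaMix] at this
    simp only [vdiff_apply (N.smooth_f.mdifferentiableAt (x := x) (by simp)),
      vdiff_apply (N.smooth_t.mdifferentiableAt (x := x) (by simp))] at this
    simp only [hD, hH, hr, hn, Function.comp_apply, e.left_inv hx]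
    exact this
  have cD := (sD.continuousOn.continuousAt hmem)
  have cH := (sH.continuousOn.continuousAt hmem)
  have hlt : ∀ᶠ z in 𝓝 (e x), D z ^ 2 < H z ^ 2 := (cD.pow 2).eventually_lt (cH.pow 2) h0
  have hΨ := contDiffAt_hypAngle (sD.contDiffAt hmem) (sH.contDiffAt hmem) h0
  have hc : ContMDiffAt 𝓘(ℝ, E2) 𝓘(ℝ, E2) ∞ e x :=
    (contMDiffOn_chart (I := 𝓘(ℝ, E2)) (x := x)).contMDiffAt (chart_source_mem_nhds E2 x)
  refine (hΨ.contMDiffAt.comp x hc).congr_of_eventuallyEq ?_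
  filter_upwards [(e.continuousAt hx).eventually hlt, e.open_source.mem_nhds hx] with y hy hys
  -- By uniqueness of the root it is enough that `frontAngle` at `y` solves the equation formed in
  -- the chart at `x`.
  refine (hypAngle_iff hy _).1 ?_
  have hz := e.map_source hys
  set P : E2 →L[ℝ] E2 := mfderiv 𝓘(ℝ, E2) 𝓘(ℝ, E2) e.symm (e y) with hP
  have hri : ∀ i, pd i r (e y) = vdiff f y (P (EuclideanSpace.single i 1)) := fun i => by
    have := fderiv_comp_symm N.smooth_f x hz (EuclideanSpace.single i 1)
    rw [← he, e.left_inv hys] at this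
    exact this
  have hni : ∀ i, pd i n (e y) = vdiff t y (P (EuclideanSpace.single i 1)) := fun i => by
    have := fderiv_comp_symm N.smooth_t x hz (EuclideanSpace.single i 1)
    rw [← he, e.left_inv hys] at this
    exact this
  have k := areaForm_map (p := p) (q := q) (f := f y) (t := t y)
    (pencil f t y (Real.cosh (frontAngle p q f t y)) (Real.sinh (frontAngle p q f t y)))
    (P (EuclideanSpace.single 0 1)) (P (EuclideanSpace.single 1 1))
  rw [h.areaForm_pencil hpq, _root_.areaForm_pencil, h.areaForm_eq hpq] at k
  have k0 := h.areaForm_frontAngle hpq humb y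
  have k1 : (Real.cosh (frontAngle p q f t y) ^ 2 + Real.sinh (frontAngle p q f t y) ^ 2) *
      areaFst p q f t y + 2 * (Real.cosh (frontAngle p q f t y) *
        Real.sinh (frontAngle p q f t y)) * areaMix p q f t y = 0 := by linarith
  rw [k1, mul_zero] at k
  simp only [hD, hH, hri, hni]
  simp only [hr, hn, Function.comp_apply, e.left_inv hys]
  linarith

/-- The involution with given fixed line and given reversed line. -/
theorem exists_involution {X₁ X₂ : E2} (hX : LinearIndependent ℝ ![X₁, X₂]) :
    ∃ J : E2 →L[ℝ] E2, (∀ X, J (J X) = X) ∧ (∀ X, J X = X → ∃ a : ℝ, X = a • X₁) ∧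
      ∀ X, J X = -X → ∃ a : ℝ, X = a • X₂ := by
  let b := basisOfLinearIndependentOfCardEqFinrank hX (by simp)
  have b0 : b 0 = X₁ := by simp [b]
  have b1 : b 1 = X₂ := by simp [b]
  let J : E2 →L[ℝ] E2 := (b.constr ℝ ![X₁, -X₂]).toContinuousLinearMap
  have j1 : J X₁ = X₁ := by
    conv_lhs => rw [← b0]
    simp [J]
  have j2 : J X₂ = -X₂ := by
    conv_lhs => rw [← b1]
    simp [J]
  have hs : ∀ X : E2, X = b.repr X 0 • X₁ + b.repr X 1 • X₂ := fun X => by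
    have := b.sum_repr X
    rw [Fin.sum_univ_two, b0, b1] at this
    exact this.symm
  have hJ : ∀ X : E2, J X = b.repr X 0 • X₁ - b.repr X 1 • X₂ := fun X => by
    conv_lhs => rw [hs X]
    rw [map_add, map_smul, map_smul, j1, j2, smul_neg, sub_eq_add_neg]
  refine ⟨J, fun X => ?_, fun X h => ⟨b.repr X 0, ?_⟩, fun X h => ⟨b.repr X 1, ?_⟩⟩
  · rw [hJ X, map_sub, map_smul, map_smul, j1, j2, smul_neg, sub_neg_eq_add]
    exact (hs X).symm
  · have e1 := hs X
    have e2 := hJ X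
    rw [h] at e2
    have : (2 : ℝ) • X = (2 : ℝ) • b.repr X 0 • X₁ := by
      generalize b.repr X 0 = m at *
      generalize b.repr X 1 = n at *
      rw [two_smul]
      nth_rewrite 1 [e1]
      rw [e2]
      module
    exact smul_right_injective _ two_ne_zero this
  · have e1 := hs X
    have e2 := hJ X
    rw [h, neg_eq_iff_eq_neg] at e2
    have : (2 : ℝ) • X = (2 : ℝ) • b.repr X 1 • X₂ := by
      generalize b.repr X 0 = m at *
      generalize b.repr X 1 = n at *
      rw [two_smul]
      nth_rewrite 1 [e1]
      rw [e2]
      module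
    exact smul_right_injective _ two_ne_zero this

/-- The area of the pencil is symmetric in its coefficients, so the angle that makes (cosh φ, sinh
φ) degenerate also does so for (sinh φ, cosh φ). A common kernel vector would kill d𝔣 and d𝔱, since
cosh² φ - sinh² φ = 1; regularity thus makes the two kernels independent. -/
theorem IsFlatFront.exists_involution (hpq : IsOrthonormalPair p q) (h : IsFlatFront p q f t)
    (humb : ∀ x, ¬ IsUmbilic f t x) (x : M) : ∃ J : E2 →L[ℝ] E2, (∀ X, J (J X) = X) ∧
      (∀ X, J X = X → Real.cosh (frontAngle p q f t x) • (vdiff t x X : R42) +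
        Real.sinh (frontAngle p q f t x) • (vdiff f x X : R42) = 0) ∧
      ∀ X, J X = -X → Real.sinh (frontAngle p q f t x) • (vdiff t x X : R42) +
        Real.cosh (frontAngle p q f t x) • (vdiff f x X : R42) = 0 := by
  have N := h.isNormalPair hpq
  have k := h.areaForm_frontAngle hpq humb x
  set c := Real.cosh (frontAngle p q f t x) with hc
  set s := Real.sinh (frontAngle p q f t x) with hs
  have hcs : c ^ 2 - s ^ 2 = 1 := Real.cosh_sq_sub_sinh_sq _
  obtain ⟨X₁, n1, z1⟩ := exists_ker_of_areaForm_eq_zero (L := pencil f t x s c) (N.frame x)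
    (fun X => N.perp_smul_add _ _ x X) (by rw [h.areaForm_pencil hpq]; linarith)
  obtain ⟨X₂, n2, z2⟩ := exists_ker_of_areaForm_eq_zero (L := pencil f t x c s) (N.frame x)
    (fun X => N.perp_smul_add _ _ x X) (by rw [h.areaForm_pencil hpq]; linarith)
  have hker : ∀ X, pencil f t x s c X = 0 → pencil f t x c s X = 0 → X = 0 := by
    intro X e1 e2
    have := eq_zero_of_smul_add_smul (by rw [hcs]; exact one_ne_zero) e2 e1
    exact h.regular x X this.1 this.2
  have hli : LinearIndependent ℝ ![X₁, X₂] := by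
    rw [LinearIndependent.pair_iff]
    intro a b hab
    have e : a • X₁ = -(b • X₂) := eq_neg_of_add_eq_zero_left hab
    have : a • X₁ = 0 := hker _ (by rw [map_smul, z1, smul_zero])
      (by rw [e, map_neg, map_smul, z2, smul_zero, neg_zero])
    refine ⟨(smul_eq_zero.1 this).resolve_right n1, ?_⟩
    rw [this, zero_add] at hab
    exact (smul_eq_zero.1 hab).resolve_right n2
  obtain ⟨J, hJ, h1, h2⟩ := _root_.exists_involution hli
  refine ⟨J, hJ, fun X e => ?_, fun X e => ?_⟩
  · obtain ⟨a, rfl⟩ := h1 X e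
    have : pencil f t x s c (a • X₁) = 0 := by rw [map_smul, z1, smul_zero]
    rw [add_comm]
    exact this
  · obtain ⟨a, rfl⟩ := h2 X e
    have : pencil f t x c s (a • X₂) = 0 := by rw [map_smul, z2, smul_zero]
    rw [add_comm]
    exact this

/-- `IsCurvatureData` asks only φ to be smooth, so the involutions may be chosen point by point. -/
theorem IsFlatFront.exists_isCurvatureData (hpq : IsOrthonormalPair p q) (h : IsFlatFront p q f t)
    (humb : ∀ x, ¬ IsUmbilic f t x) : ∃ φ J, IsCurvatureData f t φ J := by
  choose J hJ h1 h2 using h.exists_involution hpq humb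
  exact ⟨frontAngle p q f t, J, h.contMDiff_frontAngle hpq humb, hJ, h1, h2⟩

end CurvatureData

/-! ### The Moutard equations -/

section Moutard

variable {U : Set (ℝ × ℝ)} {φ : ℝ × ℝ → ℝ} {s₁ s₂ : ℝ × ℝ → R42}

theorem fderiv_fderiv_comm {F : Type*} [NormedAddCommGroup F] [NormedSpace ℝ F] (hU : IsOpen U)
    {g : ℝ × ℝ → F} (hg : ContDiffOn ℝ ∞ g U) {z : ℝ × ℝ} (hz : z ∈ U) (v w : ℝ × ℝ) :
    fderiv ℝ (fun y => fderiv ℝ g y v) z w = fderiv ℝ (fun y => fderiv ℝ g y w) z v := by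
  have hd : DifferentiableAt ℝ (fderiv ℝ g) z :=
    ((hg.fderiv_of_isOpen hU (m := ∞) (by simp)).differentiableOn (by simp)).differentiableAt
      (hU.mem_nhds hz)
  have hs : IsSymmSndFDerivAt ℝ g z :=
    (hg.contDiffAt (hU.mem_nhds hz)).isSymmSndFDerivAt (by
      simp only [minSmoothness_of_isRCLikeNormedField]
      exact WithTop.coe_le_coe.2 (le_top (a := (2 : ℕ∞))))
  rw [fderiv_clm_apply hd (differentiableAt_const _),
    fderiv_clm_apply hd (differentiableAt_const _)]
  simpa using hs w v

theorem fderiv_smul_apply_of_contDiffOn (hU : IsOpen U) {a : ℝ × ℝ → ℝ} {g : ℝ × ℝ → R42}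
    (ha : ContDiffOn ℝ ∞ a U) (hg : ContDiffOn ℝ ∞ g U) {z : ℝ × ℝ} (hz : z ∈ U) (v : ℝ × ℝ) :
    fderiv ℝ (fun y => a y • g y) z v = a z • fderiv ℝ g z v + fderiv ℝ a z v • g z := by
  rw [fderiv_fun_smul ((ha.differentiableOn (by simp)).differentiableAt (hU.mem_nhds hz))
    ((hg.differentiableOn (by simp)).differentiableAt (hU.mem_nhds hz))]
  simp

theorem contDiffOn_fderiv_apply {F : Type*} [NormedAddCommGroup F] [NormedSpace ℝ F]
    (hU : IsOpen U) {g : ℝ × ℝ → F} (hg : ContDiffOn ℝ ∞ g U) (v : ℝ × ℝ) :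
    ContDiffOn ℝ ∞ (fun y => fderiv ℝ g y v) U :=
  (hg.fderiv_of_isOpen hU (by simp)).clm_apply contDiffOn_const

/-- Differentiating the first equation in v and the second in u gives s₁,uv = φ_u φ_v s₁ + φ_uv s₂
and s₂,uv = φ_u φ_v s₂ + φ_uv s₁, so the sum is multiplied by φ_u φ_v + φ_uv. -/
theorem fderiv_fderiv_add_eq_smul (hU : IsOpen U) (hφ : ContDiffOn ℝ ∞ φ U)
    (h₁ : ContDiffOn ℝ ∞ s₁ U) (h₂ : ContDiffOn ℝ ∞ s₂ U)
    (e₁ : ∀ z ∈ U, fderiv ℝ s₁ z (1, 0) = fderiv ℝ φ z (1, 0) • s₂ z)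
    (e₂ : ∀ z ∈ U, fderiv ℝ s₂ z (0, 1) = fderiv ℝ φ z (0, 1) • s₁ z) {z : ℝ × ℝ} (hz : z ∈ U) :
    ∃ k : ℝ, fderiv ℝ (fun w => fderiv ℝ (fun y => s₁ y + s₂ y) w ((1, 0) : ℝ × ℝ)) z (0, 1) =
      k • (s₁ z + s₂ z) := by
  have d : ∀ {F : Type} [NormedAddCommGroup F] [NormedSpace ℝ F] {g : ℝ × ℝ → F},
      ContDiffOn ℝ ∞ g U → ∀ z ∈ U, DifferentiableAt ℝ g z := fun hg z hz =>
    (hg.differentiableOn (by simp)).differentiableAt (hU.mem_nhds hz)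
  have c : ∀ {g h : ℝ × ℝ → R42}, (∀ y ∈ U, g y = h y) → ∀ v, fderiv ℝ g z v = fderiv ℝ h z v :=
    fun e v => by
      rw [Filter.EventuallyEq.fderiv_eq (Filter.eventually_of_mem (hU.mem_nhds hz) e)]
  have k1 : fderiv ℝ (fun w => fderiv ℝ s₁ w ((1, 0) : ℝ × ℝ)) z (0, 1) =
      fderiv ℝ φ z (1, 0) • fderiv ℝ φ z (0, 1) • s₁ z +
        fderiv ℝ (fun w => fderiv ℝ φ w ((1, 0) : ℝ × ℝ)) z (0, 1) • s₂ z := by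
    rw [c e₁, fderiv_smul_apply_of_contDiffOn hU (contDiffOn_fderiv_apply hU hφ _) h₂ hz, e₂ z hz]
  have k2 : fderiv ℝ (fun w => fderiv ℝ s₂ w ((1, 0) : ℝ × ℝ)) z (0, 1) =
      fderiv ℝ φ z (0, 1) • fderiv ℝ φ z (1, 0) • s₂ z +
        fderiv ℝ (fun w => fderiv ℝ φ w ((1, 0) : ℝ × ℝ)) z (0, 1) • s₁ z := by
    rw [fderiv_fderiv_comm hU h₂ hz, c e₂,
      fderiv_smul_apply_of_contDiffOn hU (contDiffOn_fderiv_apply hU hφ _) h₁ hz, e₁ z hz,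
      fderiv_fderiv_comm hU hφ hz]
  refine ⟨fderiv ℝ φ z (1, 0) * fderiv ℝ φ z (0, 1) +
    fderiv ℝ (fun w => fderiv ℝ φ w ((1, 0) : ℝ × ℝ)) z (0, 1), ?_⟩
  rw [c (h := fun w => fderiv ℝ s₁ w ((1, 0) : ℝ × ℝ) + fderiv ℝ s₂ w ((1, 0) : ℝ × ℝ))
    (fun y hy => by rw [fderiv_fun_add (d h₁ y hy) (d h₂ y hy)]; rfl),
    fderiv_fun_add (d (contDiffOn_fderiv_apply hU h₁ _) z hz)
      (d (contDiffOn_fderiv_apply hU h₂ _) z hz), _root_.add_apply, k1, k2]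
  module

theorem wedge_smul_self (s : R42) (k : ℝ) : wedge s (k • s) = 0 := by
  ext v : 1
  rw [wedge_apply, ip_smul_left, smul_smul, mul_comm, sub_self]
  rfl

variable {M : Type*} [TopologicalSpace M] [ChartedSpace E2 M]
variable {p q : R42} {f t : M → R42} {φ : M → ℝ} {J : TangentEndField M}

theorem contMDiff_curvSphere₁ (hf : ContMDiff 𝓘(ℝ, E2) 𝓘(ℝ, R42) ∞ f)
    (ht : ContMDiff 𝓘(ℝ, E2) 𝓘(ℝ, R42) ∞ t) (hφ : ContMDiff 𝓘(ℝ, E2) 𝓘(ℝ, ℝ) ∞ φ) :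
    ContMDiff 𝓘(ℝ, E2) 𝓘(ℝ, R42) ∞ (curvSphere₁ p q f t φ) :=
  ((Real.contDiff_cosh.contMDiff.comp hφ).smul (contMDiff_const.add ht)).add
    ((Real.contDiff_sinh.contMDiff.comp hφ).smul (contMDiff_const.add hf))

theorem contMDiff_curvSphere₂ (hf : ContMDiff 𝓘(ℝ, E2) 𝓘(ℝ, R42) ∞ f)
    (ht : ContMDiff 𝓘(ℝ, E2) 𝓘(ℝ, R42) ∞ t) (hφ : ContMDiff 𝓘(ℝ, E2) 𝓘(ℝ, ℝ) ∞ φ) :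
    ContMDiff 𝓘(ℝ, E2) 𝓘(ℝ, R42) ∞ (curvSphere₂ p q f t φ) :=
  ((Real.contDiff_sinh.contMDiff.comp hφ).smul (contMDiff_const.add ht)).add
    ((Real.contDiff_cosh.contMDiff.comp hφ).smul (contMDiff_const.add hf))

theorem contMDiff_sPlus (hf : ContMDiff 𝓘(ℝ, E2) 𝓘(ℝ, R42) ∞ f)
    (ht : ContMDiff 𝓘(ℝ, E2) 𝓘(ℝ, R42) ∞ t) (hφ : ContMDiff 𝓘(ℝ, E2) 𝓘(ℝ, ℝ) ∞ φ) :
    ContMDiff 𝓘(ℝ, E2) 𝓘(ℝ, R42) ∞ (sPlus p q f t φ) :=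
  (contMDiff_curvSphere₁ hf ht hφ).add (contMDiff_curvSphere₂ hf ht hφ)

theorem contMDiff_sMinus (hf : ContMDiff 𝓘(ℝ, E2) 𝓘(ℝ, R42) ∞ f)
    (ht : ContMDiff 𝓘(ℝ, E2) 𝓘(ℝ, R42) ∞ t) (hφ : ContMDiff 𝓘(ℝ, E2) 𝓘(ℝ, ℝ) ∞ φ) :
    ContMDiff 𝓘(ℝ, E2) 𝓘(ℝ, R42) ∞ (sMinus p q f t φ) :=
  (contMDiff_curvSphere₁ hf ht hφ).sub (contMDiff_curvSphere₂ hf ht hφ)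

theorem contDiffOn_comp_param {F : Type*} [NormedAddCommGroup F] [NormedSpace ℝ F] {g : M → F}
    (hg : ContMDiff 𝓘(ℝ, E2) 𝓘(ℝ, F) ∞ g) {c : ℝ × ℝ → M}
    (hc : ContMDiffOn 𝓘(ℝ, ℝ × ℝ) 𝓘(ℝ, E2) ∞ c U) : ContDiffOn ℝ ∞ (g ∘ c) U :=
  contMDiffOn_iff_contDiffOn.1 (hg.comp_contMDiffOn hc)

theorem fderiv_comp_param {F : Type*} [NormedAddCommGroup F] [NormedSpace ℝ F] {g : M → F}
    (hg : ContMDiff 𝓘(ℝ, E2) 𝓘(ℝ, F) ∞ g) {c : ℝ × ℝ → M} (hU : IsOpen U)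
    (hc : ContMDiffOn 𝓘(ℝ, ℝ × ℝ) 𝓘(ℝ, E2) ∞ c U) {z : ℝ × ℝ} (hz : z ∈ U) (v : ℝ × ℝ) :
    fderiv ℝ (g ∘ c) z v = vdiff g (c z) (mfderiv 𝓘(ℝ, ℝ × ℝ) 𝓘(ℝ, E2) c z v) := by
  have := mfderiv_comp z (hg.mdifferentiableAt (by simp))
    ((hc.contMDiffAt (hU.mem_nhds hz)).mdifferentiableAt (by simp))
  rw [mfderiv_eq_fderiv] at this
  exact congrArg (fun L : ℝ × ℝ →L[ℝ] F => L v) this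

theorem fderiv_cosh_smul_add_sinh_smul {φ : ℝ × ℝ → ℝ} {a b : ℝ × ℝ → R42} {z : ℝ × ℝ}
    (hφ : DifferentiableAt ℝ φ z) (ha : DifferentiableAt ℝ a z) (hb : DifferentiableAt ℝ b z)
    (v : ℝ × ℝ) :
    fderiv ℝ (fun y => Real.cosh (φ y) • (p + a y) + Real.sinh (φ y) • (q + b y)) z v =
      fderiv ℝ φ z v • (Real.sinh (φ z) • (p + a z) + Real.cosh (φ z) • (q + b z)) +
        (Real.cosh (φ z) • fderiv ℝ a z v + Real.sinh (φ z) • fderiv ℝ b z v) := by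
  rw [((hφ.hasFDerivAt.cosh.fun_smul (ha.hasFDerivAt.const_add p)).fun_add
    (hφ.hasFDerivAt.sinh.fun_smul (hb.hasFDerivAt.const_add q))).fderiv]
  simp only [_root_.add_apply, _root_.smul_apply,
    ContinuousLinearMap.smulRight_apply, smul_eq_mul]
  module

/-- Differentiating the hyperbolic functions exchanges s₁ and s₂; the other terms form the left side
of the curvature equation and vanish. -/
theorem IsCurvatureData.curvSphere_param (h : IsCurvatureData f t φ J)
    (hf : ContMDiff 𝓘(ℝ, E2) 𝓘(ℝ, R42) ∞ f) (ht : ContMDiff 𝓘(ℝ, E2) 𝓘(ℝ, R42) ∞ t)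
    {c : ℝ × ℝ → M} (hc : IsCurvatureLineParam J U c) {z : ℝ × ℝ} (hz : z ∈ U) :
    fderiv ℝ (curvSphere₁ p q f t φ ∘ c) z (1, 0) =
      fderiv ℝ (φ ∘ c) z (1, 0) • (curvSphere₂ p q f t φ ∘ c) z ∧
    fderiv ℝ (curvSphere₂ p q f t φ ∘ c) z (0, 1) =
      fderiv ℝ (φ ∘ c) z (0, 1) • (curvSphere₁ p q f t φ ∘ c) z := by
  obtain ⟨hU, hcs, hJ⟩ := hc
  obtain ⟨-, j1, j2⟩ := hJ z hz
  have dφ := ((contDiffOn_comp_param h.smooth hcs).differentiableOn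
    (by simp)).differentiableAt (hU.mem_nhds hz)
  have df := ((contDiffOn_comp_param hf hcs).differentiableOn
    (by simp)).differentiableAt (hU.mem_nhds hz)
  have dt := ((contDiffOn_comp_param ht hcs).differentiableOn
    (by simp)).differentiableAt (hU.mem_nhds hz)
  constructor
  · refine (fderiv_cosh_smul_add_sinh_smul (p := p) (q := q) dφ dt df _).trans ?_
    have := h.dir_fst (c z) _ j1
    rw [fderiv_comp_param hf hU hcs hz, fderiv_comp_param ht hU hcs hz]
    refine Eq.trans ?_ (add_zero _)
    exact congrArg _ this
  · have e : curvSphere₂ p q f t φ ∘ c = fun y => Real.cosh ((φ ∘ c) y) • (q + (f ∘ c) y) +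
        Real.sinh ((φ ∘ c) y) • (p + (t ∘ c) y) := by
      ext1 y
      exact add_comm _ _
    rw [e]
    refine (fderiv_cosh_smul_add_sinh_smul (p := q) (q := p) dφ df dt _).trans ?_
    have := h.dir_snd (c z) _ j2
    rw [fderiv_comp_param hf hU hcs hz, fderiv_comp_param ht hU hcs hz]
    refine Eq.trans ?_ (add_zero _)
    refine congrArg₂ (· + ·) ?_ ((add_comm _ _).trans this)
    exact congrArg _ (add_comm _ _)

theorem IsCurvatureData.isMoutardLift_sPlus (h : IsCurvatureData f t φ J)
    (hf : ContMDiff 𝓘(ℝ, E2) 𝓘(ℝ, R42) ∞ f) (ht : ContMDiff 𝓘(ℝ, E2) 𝓘(ℝ, R42) ∞ t) :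
    IsMoutardLift J (sPlus p q f t φ) := by
  refine ⟨contMDiff_sPlus hf ht h.smooth, fun U c hc z hz => ?_⟩
  obtain ⟨k, hk⟩ := fderiv_fderiv_add_eq_smul hc.1 (contDiffOn_comp_param h.smooth hc.2.1)
    (contDiffOn_comp_param (contMDiff_curvSphere₁ (p := p) (q := q) hf ht h.smooth) hc.2.1)
    (contDiffOn_comp_param (contMDiff_curvSphere₂ (p := p) (q := q) hf ht h.smooth) hc.2.1)
    (fun z hz => (h.curvSphere_param hf ht hc hz).1)
    (fun z hz => (h.curvSphere_param hf ht hc hz).2) hz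
  have hk' : fderiv ℝ (fun w => fderiv ℝ (sPlus p q f t φ ∘ c) w ((1, 0) : ℝ × ℝ)) z (0, 1) =
    k • sPlus p q f t φ (c z) := hk
  rw [hk', wedge_smul_self]

theorem IsCurvatureData.isMoutardLift_sMinus (h : IsCurvatureData f t φ J)
    (hf : ContMDiff 𝓘(ℝ, E2) 𝓘(ℝ, R42) ∞ f) (ht : ContMDiff 𝓘(ℝ, E2) 𝓘(ℝ, R42) ∞ t) :
    IsMoutardLift J (sMinus p q f t φ) := by
  refine ⟨contMDiff_sMinus hf ht h.smooth, fun U c hc z hz => ?_⟩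
  -- The equations for s₁, s₂ are invariant under (φ, s₂) ↦ (-φ, -s₂), which turns s⁺ into s⁻.
  obtain ⟨k, hk⟩ := fderiv_fderiv_add_eq_smul hc.1 (contDiffOn_comp_param h.smooth hc.2.1).neg
    (contDiffOn_comp_param (contMDiff_curvSphere₁ (p := p) (q := q) hf ht h.smooth) hc.2.1)
    (contDiffOn_comp_param (contMDiff_curvSphere₂ (p := p) (q := q) hf ht h.smooth) hc.2.1).neg
    (fun z hz => by
      rw [fderiv_fun_neg, _root_.neg_apply, smul_neg, neg_smul, neg_neg]
      exact (h.curvSphere_param hf ht hc hz).1)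
    (fun z hz => by
      rw [fderiv_fun_neg, fderiv_fun_neg, _root_.neg_apply,
        _root_.neg_apply, neg_smul]
      exact congrArg _ (h.curvSphere_param hf ht hc hz).2) hz
  simp only [← sub_eq_add_neg] at hk
  have hk' : fderiv ℝ (fun w => fderiv ℝ (sMinus p q f t φ ∘ c) w ((1, 0) : ℝ × ℝ)) z (0, 1) =
    k • sMinus p q f t φ (c z) := hk
  rw [hk', wedge_smul_self]

end Moutard

/-! ### Calapso transformations and the flatness of the deformed front -/

section Deformation

variable {M : Type*} {p q : R42} {f t : M → R42} {φ : M → ℝ}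

theorem sPlus_eq (x : M) :
    sPlus p q f t φ x = Real.exp (φ x) • (p + t x + (q + f x)) := by
  rw [sPlus, curvSphere₁, curvSphere₂, ← Real.cosh_add_sinh]
  module

theorem sMinus_eq (x : M) :
    sMinus p q f t φ x = Real.exp (-φ x) • (p + t x - (q + f x)) := by
  rw [sMinus, curvSphere₁, curvSphere₂, ← Real.cosh_sub_sinh]
  module

theorem eq_zero_of_forall_ip_eq_zero {v : R42} (h : ∀ w, ip v w = 0) : v = 0 := by
  ext i
  have := h (Pi.single i 1)
  simp [ip, Pi.single_apply] at this
  rcases this with h | h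
  · fin_cases i <;> simp [lieSign] at h
  · exact h

variable [TopologicalSpace M] [ChartedSpace E2 M] {J : TangentEndField M}

/-- A Calapso transformation acts on fields orthogonal to `s` and `ds` like a constant map. -/
theorem IsCalapso.vdiff_apply {s g : M → R42} {lam : ℝ} {T : M → R42 →L[ℝ] R42}
    (h : IsCalapso J s lam T) (hg : ContMDiff 𝓘(ℝ, E2) 𝓘(ℝ, R42) ∞ g)
    (h0 : ∀ x, ip (s x) (g x) = 0) (h1 : ∀ (x : M) (X : E2), ip (vdiff s x X) (g x) = 0) (x : M)
    (X : E2) : (vdiff (fun y => T y (g y)) x X : R42) = T x (vdiff g x X) := by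
  rw [vdiff_clm_apply h.smooth hg]
  have e : (vdiff T x X : R42 →L[ℝ] R42) = (T x).comp (lam • calapsoForm J s x X) :=
    h.deriv_eq x X
  have z : calapsoForm J s x X (g x) = 0 := by
    change wedge (s x) (vdiff s x (J x X)) (g x) = 0
    rw [wedge_apply, h0, zero_smul, zero_sub, neg_eq_zero]
    exact (congrArg (· • s x) (h1 x (J x X))).trans (zero_smul _ _)
  rw [e, ContinuousLinearMap.comp_apply, _root_.smul_apply, z, smul_zero, map_zero, add_zero]

/-- A Calapso transformation maps a constant vector orthogonal to `s` to a constant vector. -/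
theorem IsCalapso.apply_eq [IsManifold 𝓘(ℝ, E2) ∞ M] [ConnectedSpace M] {s : M → R42} {lam : ℝ}
    {T : M → R42 →L[ℝ] R42} (h : IsCalapso J s lam T)
    (hs : ContMDiff 𝓘(ℝ, E2) 𝓘(ℝ, R42) ∞ s) {v : R42} (h0 : ∀ x, ip (s x) v = 0) (x y : M) :
    T x v = T y v := by
  refine eq_of_vdiff_eq_zero (g := fun x => T x v) (h.smooth.clm_apply contMDiff_const)
    (fun x => ContinuousLinearMap.ext fun X => ?_) x y
  refine (h.vdiff_apply contMDiff_const h0 (fun x X => ?_) x X).trans ?_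
  · have := ip_vdiff_of_const hs (contMDiff_const (c := v)) h0 x X
    rwa [vdiff_const, ip_zero_right, add_zero] at this
  · exact (congrArg (T x) (vdiff_const v x X)).trans (map_zero _)

namespace IsNormalPair

theorem ip_sPlus (h : IsNormalPair p q f t) (x : M) :
    ip (sPlus p q f t φ x) (p + t x) = 0 ∧ ip (sPlus p q f t φ x) (q + f x) = 0 ∧
    ip (sPlus p q f t φ x) (p + q) = 0 ∧
    ip (sPlus p q f t φ x) (p - q) = -2 * Real.exp (φ x) := by
  have F := h.frame x
  rw [sPlus_eq]
  refine ⟨?_, ?_, ?_, ?_⟩ <;>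
  · simp only [ip_smul_left, ip_add_left, ip_add_right, ip_sub_right, F.pp, F.qq, F.ff, F.tt, F.pq,
      F.fp, F.fq, F.tp, F.tq, F.tf, ip_comm q p, ip_comm p (f x), ip_comm q (f x),
      ip_comm p (t x), ip_comm q (t x), ip_comm (f x) (t x)]
    ring

theorem ip_sMinus (h : IsNormalPair p q f t) (x : M) :
    ip (sMinus p q f t φ x) (p + t x) = 0 ∧ ip (sMinus p q f t φ x) (q + f x) = 0 ∧
    ip (sMinus p q f t φ x) (p - q) = 0 ∧
    ip (sMinus p q f t φ x) (p + q) = -2 * Real.exp (-φ x) := by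
  have F := h.frame x
  rw [sMinus_eq]
  refine ⟨?_, ?_, ?_, ?_⟩ <;>
  · simp only [ip_smul_left, ip_add_left, ip_add_right, ip_sub_right, ip_sub_left, F.pp, F.qq, F.ff,
      F.tt, F.pq, F.fp, F.fq, F.tp, F.tq, F.tf, ip_comm q p, ip_comm p (f x), ip_comm q (f x),
      ip_comm p (t x), ip_comm q (t x), ip_comm (f x) (t x)]
    ring

/-- For a section σ of f, (ds⁺, σ) = -(s⁺, dσ), and the differentials of 𝔭 + 𝔱 and 𝔮 + 𝔣 are
orthogonal to the contact element. Hence τ⁺ annihilates f. -/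
theorem ip_vdiff_sPlus (h : IsNormalPair p q f t) (hφ : ContMDiff 𝓘(ℝ, E2) 𝓘(ℝ, ℝ) ∞ φ) (x : M)
    (X : E2) : ip (vdiff (sPlus p q f t φ) x X) (p + t x) = 0 ∧
      ip (vdiff (sPlus p q f t φ) x X) (q + f x) = 0 := by
  have hs := contMDiff_sPlus (p := p) (q := q) h.smooth_f h.smooth_t hφ
  have a := h.perp_f x X
  have b := h.perp_t x X
  constructor
  · have e := ip_vdiff_of_const hs ((contMDiff_const (c := p)).add h.smooth_t)
      (fun x => (h.ip_sPlus x).1) x X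
    have e' := vdiff_add (contMDiff_const (c := p)) h.smooth_t x X
    rw [vdiff_const, zero_add] at e'
    have z : ip (sPlus p q f t φ x) (vdiff t x X) = 0 := by
      rw [sPlus_eq, ip_comm, ip_smul_right]
      simp only [ip_add_right, b.p, b.q, b.f, b.t]
      ring
    have e2 : ip (sPlus p q f t φ x) (vdiff ((fun _ => p) + t) x X) = 0 :=
      (congrArg (ip _) e').trans z
    rw [e2, add_zero] at e
    exact e
  · have e := ip_vdiff_of_const hs ((contMDiff_const (c := q)).add h.smooth_f)
      (fun x => (h.ip_sPlus x).2.1) x X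
    have e' := vdiff_add (contMDiff_const (c := q)) h.smooth_f x X
    rw [vdiff_const, zero_add] at e'
    have z : ip (sPlus p q f t φ x) (vdiff f x X) = 0 := by
      rw [sPlus_eq, ip_comm, ip_smul_right]
      simp only [ip_add_right, a.p, a.q, a.f, a.t]
      ring
    have e2 : ip (sPlus p q f t φ x) (vdiff ((fun _ => q) + f) x X) = 0 :=
      (congrArg (ip _) e').trans z
    rw [e2, add_zero] at e
    exact e

end IsNormalPair

/-- A function without zeros on a connected space has constant sign. -/
theorem neg_of_ne_zero {X : Type*} [TopologicalSpace X] [ConnectedSpace X] {g : X → ℝ}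
    (hg : Continuous g) (h0 : ∀ x, g x ≠ 0) {x : X} (hx : g x < 0) (y : X) : g y < 0 := by
  by_contra hy
  obtain ⟨z, hz⟩ := mem_range_of_exists_le_of_exists_ge hg ⟨x, hx.le⟩ ⟨y, not_lt.1 hy⟩
  exact h0 z hz

/-- (𝔣(x), 𝔣(x₀)) never vanishes: otherwise the timelike 𝔣(x) would be orthogonal to the timelike 𝔭
and 𝔣(x₀), whose complement is positive definite. On a connected surface its sign is constant. -/
theorem IsNormalPair.exists_mem_hyperbolicSpace [ConnectedSpace M] (h : IsNormalPair p q f t) :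
    ∃ o, ip o p = 0 ∧ ip o q = 0 ∧ ip o o = -1 ∧ ∀ x, f x ∈ hyperbolicSpace p q o := by
  obtain ⟨x₀⟩ := (inferInstance : Nonempty M)
  have F := h.frame x₀
  refine ⟨f x₀, F.fp, F.fq, F.ff, fun x => ⟨(h.frame x).fp, (h.frame x).fq, (h.frame x).ff, ?_⟩⟩
  refine neg_of_ne_zero (g := fun x => ip (f x) (f x₀))
    (h.smooth_f.ip contMDiff_const).continuous (fun y hy => ?_) (x := x₀)
    (by simp only [F.ff]; norm_num) x
  have := eq_zero_of_ip_self_nonpos F.pp F.ff (by rw [ip_comm, F.fp]) (h.frame y).fp hy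
    (by rw [(h.frame y).ff]; norm_num)
  have e := (h.frame y).ff
  rw [this, ip_zero_left] at e
  norm_num at e

/-- The image of a flat front under the Lie geometric deformation. -/
theorem IsFlatFront.of_pencil [IsManifold 𝓘(ℝ, E2) ∞ M] [ConnectedSpace M]
    (hpq : IsOrthonormalPair p q) (h : IsFlatFront p q f t)
    (humb : ∀ x, ¬ IsUmbilic f t x) {lam : ℝ} (hl : lam ≠ 1 / 2) {p' q' : R42} {f' t' : M → R42}
    (N' : IsNormalPair p' q' f' t') {T : M → R42 →L[ℝ] R42}
    (hT : ∀ x v w, ip (T x v) (T x w) = ip v w)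
    (hf' : ∀ (x : M) (X : E2), vdiff f' x X = T x (pencil f t x (1 - lam) (-lam) X))
    (ht' : ∀ (x : M) (X : E2), vdiff t' x X = T x (pencil f t x (-lam) (1 - lam) X)) :
    IsFlatFront p' q' f' t' := by
  have N := h.isNormalPair hpq
  have hl' : 1 - 2 * lam ≠ 0 := fun e => hl (by linarith)
  have hTi : ∀ x v, T x v = 0 → v = 0 := fun x v hv =>
    eq_zero_of_forall_ip_eq_zero fun w => by rw [← hT x, hv, ip_zero_left]
  refine ⟨N'.smooth_f, N'.smooth_t, N'.exists_mem_hyperbolicSpace,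
    fun x => ⟨(N'.frame x).tp, (N'.frame x).tq⟩, fun x => (N'.frame x).tt,
    fun x => (N'.frame x).tf, N'.orth, fun x X h1 h2 => ?_, fun x => ?_⟩
  · have e1 : (1 - lam) • (vdiff f x X : R42) + (-lam) • (vdiff t x X : R42) = 0 :=
      hTi x _ ((hf' x X).symm.trans h1)
    have e2 : (-lam) • (vdiff f x X : R42) + (1 - lam) • (vdiff t x X : R42) = 0 :=
      hTi x _ ((ht' x X).symm.trans h2)
    have := eq_zero_of_smul_add_smul (fun e => hl' (by linear_combination e)) e1 e2
    exact h.regular x X this.1 this.2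
  · have hfδ : ∀ (δ : ℝ) (y : M) (X : E2), vdiff (parallelFront f' t' δ) y X =
        T y (pencil f t y ((1 - lam) * Real.cosh δ - lam * Real.sinh δ)
          ((1 - lam) * Real.sinh δ - lam * Real.cosh δ) X) := fun δ y X => by
      rw [vdiff_parallelFront N'.smooth_f N'.smooth_t, hf', ht', pencil_apply,
        pencil_apply, pencil_apply, ← (T y).map_smul, ← (T y).map_smul, ← (T y).map_add]
      congr 1
      module
    have htδ : ∀ (δ : ℝ) (y : M) (X : E2), vdiff (parallelNormal f' t' δ) y X =
        T y (pencil f t y ((1 - lam) * Real.sinh δ - lam * Real.cosh δ)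
          ((1 - lam) * Real.cosh δ - lam * Real.sinh δ) X) := fun δ y X => by
      rw [vdiff_parallelNormal N'.smooth_f N'.smooth_t, hf', ht', pencil_apply,
        pencil_apply, pencil_apply, ← (T y).map_smul, ← (T y).map_smul, ← (T y).map_add]
      congr 1
      module
    -- The coefficients have sum (1 - 2λ)e^δ and difference e^(-δ), so twice the area is (1 - 2λ)²
    -- e^(2δ) (D + H) + e^(-2δ) (D - H). Vanishing at δ = 0 and δ = 1 would force D = -H, against D²
    -- < H².
    have hδ : ∃ δ : ℝ, areaForm p q (f x) (t x)
        (pencil f t x ((1 - lam) * Real.cosh δ - lam * Real.sinh δ)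
          ((1 - lam) * Real.sinh δ - lam * Real.cosh δ) (EuclideanSpace.single 0 1))
        (pencil f t x ((1 - lam) * Real.cosh δ - lam * Real.sinh δ)
          ((1 - lam) * Real.sinh δ - lam * Real.cosh δ) (EuclideanSpace.single 1 1)) ≠ 0 := by
      by_contra! hc
      simp only [h.areaForm_pencil hpq] at hc
      have hlt := h.areaFst_sq_lt hpq humb x
      set D := areaFst p q f t x
      set H := areaMix p q f t x
      have h0 := hc 0
      have h1 := hc 1
      rw [Real.cosh_zero, Real.sinh_zero] at h0
      have h2 : 2 * (Real.cosh 1 * Real.sinh 1) *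
          ((1 - 2 * lam) ^ 2 * (D + H) + (H - D)) = 0 := by
        linear_combination 2 * h1 - (2 * (Real.cosh 1 ^ 2 + Real.sinh 1 ^ 2)) * h0
      have hsc : 2 * (Real.cosh 1 * Real.sinh 1) ≠ 0 := by
        have := Real.sinh_pos_iff.2 one_pos
        have := Real.cosh_pos 1
        positivity
      have h3 := (mul_eq_zero.1 h2).resolve_left hsc
      have h4 : (1 - 2 * lam) ^ 2 * (D + H) = 0 := by linear_combination h0 + h3 / 2
      have h5 := (mul_eq_zero.1 h4).resolve_left (pow_ne_zero 2 hl')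
      rw [eq_neg_of_add_eq_zero_left h5, neg_sq] at hlt
      exact lt_irrefl _ hlt
    obtain ⟨δ, hδ⟩ := hδ
    refine ⟨δ, ?_⟩
    have hinj : Function.Injective (vdiff (parallelFront f' t' δ) x) := by
      intro X Y hXY
      have := (hfδ δ x X).symm.trans (hXY.trans (hfδ δ x Y))
      rw [← sub_eq_zero, ← map_sub] at this
      exact injective_of_areaForm_ne_zero hδ (sub_eq_zero.1 (hTi x _ this))
    filter_upwards [eventually_injective_vdiff
      (contMDiff_parallelFront N'.smooth_f N'.smooth_t δ) hinj] with y hy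
    refine ⟨hy, ((N'.parallel δ).gaussCurvature_eq_zero_iff hy).2 ?_⟩
    simp only [hfδ, htδ, hT]
    simp only [pencil_apply]
    rw [← areaForm_mul (N.frame y) (N.perp_smul_add _ _ y _) (N.perp_smul_add _ _ y _)
      (N.perp_smul_add _ _ y _) (N.perp_smul_add _ _ y _), ← areaForm_mul (N.frame y)
      (N.perp_smul_add _ _ y _) (N.perp_smul_add _ _ y _) (N.perp_smul_add _ _ y _)
      (N.perp_smul_add _ _ y _)]
    -- The normal has the coefficients of the parallel surface in exchanged order, and the pencil
    -- area is symmetric in them.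
    simp only [← pencil_apply, h.areaForm_pencil hpq]
    ring

end Deformation

/-! ### The new infinity sphere and the deformed front -/

section Main

theorem span_pair_comb {u v : R42} {lam : ℝ} (hl : 1 - 2 * lam ≠ 0) :
    Submodule.span ℝ {(1 - lam) • u + (-lam) • v, (-lam) • u + (1 - lam) • v} =
      Submodule.span ℝ {u, v} := by
  apply le_antisymm <;> rw [Submodule.span_le, Set.pair_subset_iff]
  · exact ⟨Submodule.mem_span_pair.2 ⟨_, _, rfl⟩, Submodule.mem_span_pair.2 ⟨_, _, rfl⟩⟩
  · have hc : 1 / (1 - 2 * lam) * (1 - 2 * lam) = 1 := div_mul_cancel₀ _ hl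
    generalize 1 / (1 - 2 * lam) = c at hc
    refine ⟨Submodule.mem_span_pair.2 ⟨(1 - lam) * c, lam * c, ?_⟩,
      Submodule.mem_span_pair.2 ⟨lam * c, (1 - lam) * c, ?_⟩⟩
    · linear_combination (norm := module) hc • u
    · linear_combination (norm := module) hc • v

/-- With `half_sub_smul`, this expresses the new 𝔭', 𝔮' in the moving frame, before T⁺ is applied.
-/
theorem half_add_smul {p q f t : R42} {lam c : ℝ} (hc : c * (1 - 2 * lam) = 1) :
    (1 / 2 : ℝ) • (p + q + c • (p - q - (2 * lam) • (p + t - (q + f)))) =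
      p - (lam * c) • (t - f) := by
  linear_combination (norm := module) (hc / 2) • (p - q)

theorem half_sub_smul {p q f t : R42} {lam c : ℝ} (hc : c * (1 - 2 * lam) = 1) :
    (1 / 2 : ℝ) • (p + q - c • (p - q - (2 * lam) • (p + t - (q + f)))) =
      q + (lam * c) • (t - f) := by
  linear_combination (norm := module) (-hc / 2) • (p - q)

theorem clm_add_wedge_apply (T : R42 →L[ℝ] R42) (k : ℝ) (a b v : R42) :
    T.comp (ContinuousLinearMap.id ℝ R42 + k • wedge a b) v =
      T (v + k • (ip a v • b - ip b v • a)) := rfl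

variable {M : Type*} [TopologicalSpace M] [ChartedSpace E2 M]
variable {p q : R42} {f t : M → R42} {φ : M → ℝ} {J : TangentEndField M} {lam : ℝ}
variable {Tp Tm T : M → R42 →L[ℝ] R42}

/-- On the contact elements, the three transformations agree. -/
theorem IsLieDeformation.apply_contact
    (hT : IsLieDeformation J (sPlus p q f t φ) (sMinus p q f t φ) lam Tp Tm T)
    (x : M) {v : R42} (h1 : ip (sPlus p q f t φ x) v = 0)
    (h2 : ip (sMinus p q f t φ x) v = 0) : T x v = Tp x v ∧ T x v = Tm x v := by
  rw [hT.eq_plus x, clm_add_wedge_apply, h1, h2]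
  refine ⟨by simp, ?_⟩
  have := hT.eq_minus x
  rw [hT.eq_plus x] at this
  have := congrArg (fun L : R42 →L[ℝ] R42 => L v) this
  rw [clm_add_wedge_apply, clm_add_wedge_apply, h1, h2] at this
  simpa using this

/-- As s⁺ is null and orthogonal to s⁻ and q⁺, the factor 1 + (λ/2) s⁺ ∧ s⁻ fixes s⁺ and shifts q⁺
by exactly the opposite of the correction term. The vector of the theorem is therefore the constant
T⁺q⁺. -/
theorem IsLieDeformation.apply_plus
    (hT : IsLieDeformation J (sPlus p q f t φ) (sMinus p q f t φ) lam Tp Tm T)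
    (N : IsNormalPair p q f t) (x : M) :
    T x (p + q + (lam / 2 * ip (p + q) (sMinus p q f t φ x)) • sPlus p q f t φ x) =
      Tp x (p + q) := by
  have a := N.ip_sPlus (φ := φ) x
  have b := N.ip_sMinus (φ := φ) x
  have e1 : ip (sPlus p q f t φ x) (sPlus p q f t φ x) = 0 := by
    nth_rewrite 2 [sPlus_eq]
    rw [ip_smul_right, ip_add_right, a.1, a.2.1]
    ring
  have e2 : ip (sMinus p q f t φ x) (sPlus p q f t φ x) = 0 := by
    rw [sPlus_eq, ip_smul_right, ip_add_right, b.1, b.2.1]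
    ring
  rw [hT.eq_plus x, clm_add_wedge_apply]
  congr 1
  rw [ip_add_right _ (p + q), ip_add_right _ (p + q), ip_smul_right, ip_smul_right, e1, e2, a.2.2.1,
    ip_comm (p + q)]
  module

/-- The second equation brings T⁻q⁻ into the frame of T⁺, for comparison with T⁺q⁺. There the shift
and the correction term add up to λ(q⁻, s⁺) s⁻, and (q⁻, s⁺) = -2e^φ cancels the factor e^(-φ) of
s⁻. -/
theorem IsLieDeformation.apply_minus
    (hT : IsLieDeformation J (sPlus p q f t φ) (sMinus p q f t φ) lam Tp Tm T)
    (N : IsNormalPair p q f t) (x : M) :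
    T x (p - q + (lam / 2 * ip (p - q) (sPlus p q f t φ x)) • sMinus p q f t φ x) =
      Tm x (p - q) ∧
    Tm x (p - q) = Tp x (p - q - (2 * lam) • (p + t x - (q + f x))) := by
  have a := N.ip_sPlus (φ := φ) x
  have b := N.ip_sMinus (φ := φ) x
  have e1 : ip (sMinus p q f t φ x) (sMinus p q f t φ x) = 0 := by
    nth_rewrite 2 [sMinus_eq]
    rw [ip_smul_right, ip_sub_right, b.1, b.2.1]
    ring
  have e2 : ip (sPlus p q f t φ x) (sMinus p q f t φ x) = 0 := by
    rw [sMinus_eq, ip_smul_right, ip_sub_right, a.1, a.2.1]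
    ring
  have k : T x (p - q + (lam / 2 * ip (p - q) (sPlus p q f t φ x)) • sMinus p q f t φ x) =
      Tm x (p - q) := by
    rw [hT.eq_minus x, clm_add_wedge_apply]
    congr 1
    rw [ip_add_right _ (p - q), ip_add_right _ (p - q), ip_smul_right, ip_smul_right, e1, e2,
      b.2.2.1, ip_comm (p - q)]
    module
  refine ⟨k, ?_⟩
  rw [← k, hT.eq_plus x, clm_add_wedge_apply]
  congr 1
  rw [ip_add_right _ (p - q), ip_add_right _ (p - q), ip_smul_right, ip_smul_right, e1, e2,
    b.2.2.1, ip_comm (p - q), a.2.2.2, sMinus_eq]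
  have e : Real.exp (φ x) * Real.exp (-φ x) = 1 := by rw [← Real.exp_add, add_neg_cancel,
    Real.exp_zero]
  simp only [smul_smul]
  linear_combination (norm := module) (-2 * lam * e) • (p + t x - (q + f x))

variable [IsManifold 𝓘(ℝ, E2) ∞ M] [ConnectedSpace M]

theorem IsFlatFront.lie_deformation (hpq : IsOrthonormalPair p q) (h : IsFlatFront p q f t)
    (humb : ∀ x, ¬ IsUmbilic f t x) (hφ : ContMDiff 𝓘(ℝ, E2) 𝓘(ℝ, ℝ) ∞ φ) (hl : lam ≠ 1 / 2)
    (hT : IsLieDeformation J (sPlus p q f t φ) (sMinus p q f t φ) lam Tp Tm T) :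
    ∃ (p' q' : R42) (f' t' : M → R42),
      IsOrthonormalPair p' q' ∧ IsFlatFront p' q' f' t' ∧
      (∀ x,
        (legendreLift p q f t x).map (T x).toLinearMap = legendreLift p' q' f' t' x ∧
        (legendreLift p q f t x).map (Tp x).toLinearMap = legendreLift p' q' f' t' x ∧
        (legendreLift p q f t x).map (Tm x).toLinearMap = legendreLift p' q' f' t' x) ∧
      ∃ a b : ℝ, ∀ x,
        p' + q' = a • T x (p + q +
          (lam / 2 * ip (p + q) (sMinus p q f t φ x)) • sPlus p q f t φ x) ∧
        p' - q' = b • T x (p - q +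
          (lam / 2 * ip (p - q) (sPlus p q f t φ x)) • sMinus p q f t φ x) := by
  have N := h.isNormalPair hpq
  have hl' : 1 - 2 * lam ≠ 0 := fun e => hl (by linarith)
  have sp := contMDiff_sPlus (p := p) (q := q) N.smooth_f N.smooth_t hφ
  have sm := contMDiff_sMinus (p := p) (q := q) N.smooth_f N.smooth_t hφ
  obtain ⟨x₀⟩ := (inferInstance : Nonempty M)
  have cp := fun x => hT.calapso_plus.apply_eq sp (fun x => (N.ip_sPlus x).2.2.1) x₀ x
  have cm := fun x => hT.calapso_minus.apply_eq sm (fun x => (N.ip_sMinus x).2.2.1) x₀ x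
  have orth := hT.calapso_plus.orthogonal
  -- T⁺q⁺ and T⁻q⁻ have product -2(1 - 2λ); scaling the second by c = 1/(1 - 2λ) restores the value
  -- -2, so that 𝔭' and 𝔮' are orthonormal.
  obtain ⟨c, hc⟩ : ∃ c : ℝ, c * (1 - 2 * lam) = 1 := ⟨_, inv_mul_cancel₀ hl'⟩
  set k : ℝ := lam * c with hk
  have hkl : k * (1 - 2 * lam) = lam := by rw [hk, mul_assoc, hc, mul_one]
  set p' : R42 := (1 / 2 : ℝ) • (Tp x₀ (p + q) + c • Tm x₀ (p - q)) with hp'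
  set q' : R42 := (1 / 2 : ℝ) • (Tp x₀ (p + q) - c • Tm x₀ (p - q)) with hq'
  have ep : ∀ x, p' = Tp x (p - k • (t x - f x)) := fun x => by
    rw [hp', cp x, cm x, (hT.apply_minus N x).2, ← (Tp x).map_smul, ← (Tp x).map_add,
      ← (Tp x).map_smul, half_add_smul hc]
  have eq : ∀ x, q' = Tp x (q + k • (t x - f x)) := fun x => by
    rw [hq', cp x, cm x, (hT.apply_minus N x).2, ← (Tp x).map_smul, ← (Tp x).map_sub,
      ← (Tp x).map_smul, half_sub_smul hc]
  -- The coefficients are those for which T⁺`gf` has products 0 and 1 with 𝔭' and 𝔮', and T⁺`gt` has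
  -- products -1 and 0, as 𝔮' + 𝔣' and 𝔭' + 𝔱' must.
  set gf : M → R42 := fun x => (1 - lam) • (q + f x) + (-lam) • (p + t x) with hgf
  set gt : M → R42 := fun x => (-lam) • (q + f x) + (1 - lam) • (p + t x) with hgt
  have sa : ContMDiff 𝓘(ℝ, E2) 𝓘(ℝ, R42) ∞ fun x => q + f x := contMDiff_const.add N.smooth_f
  have sb : ContMDiff 𝓘(ℝ, E2) 𝓘(ℝ, R42) ∞ fun x => p + t x := contMDiff_const.add N.smooth_t
  have sgf : ContMDiff 𝓘(ℝ, E2) 𝓘(ℝ, R42) ∞ gf :=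
    (contMDiff_const_smul _ sa).add (contMDiff_const_smul _ sb)
  have sgt : ContMDiff 𝓘(ℝ, E2) 𝓘(ℝ, R42) ∞ gt :=
    (contMDiff_const_smul _ sa).add (contMDiff_const_smul _ sb)
  have dcomb : ∀ (a b : ℝ) (x : M) (X : E2),
      vdiff (fun x => a • (q + f x) + b • (p + t x)) x X = pencil f t x a b X := fun a b x X => by
    rw [vdiff_add (contMDiff_const_smul _ sa) (contMDiff_const_smul _ sb), vdiff_const_smul _ sa,
      vdiff_const_smul _ sb, vdiff_add contMDiff_const N.smooth_f,
      vdiff_add contMDiff_const N.smooth_t, vdiff_const, vdiff_const, zero_add, zero_add,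
      pencil_apply]
  have sTf : ContMDiff 𝓘(ℝ, E2) 𝓘(ℝ, R42) ∞ fun x => Tp x (gf x) :=
    hT.calapso_plus.smooth.clm_apply sgf
  have sTt : ContMDiff 𝓘(ℝ, E2) 𝓘(ℝ, R42) ∞ fun x => Tp x (gt x) :=
    hT.calapso_plus.smooth.clm_apply sgt
  have dT : ∀ (a b : ℝ) (x : M) (X : E2),
      vdiff (fun x => Tp x (a • (q + f x) + b • (p + t x))) x X = Tp x (pencil f t x a b X) :=
    fun a b x X => by
      have hg : ContMDiff 𝓘(ℝ, E2) 𝓘(ℝ, R42) ∞ fun x => a • (q + f x) + b • (p + t x) :=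
        (contMDiff_const_smul _ sa).add (contMDiff_const_smul _ sb)
      rw [hT.calapso_plus.vdiff_apply hg
        (fun x => by rw [ip_add_right, ip_smul_right, ip_smul_right, (N.ip_sPlus x).1,
          (N.ip_sPlus x).2.1]; ring)
        (fun x X => by rw [ip_add_right, ip_smul_right, ip_smul_right, (N.ip_vdiff_sPlus hφ x X).1,
          (N.ip_vdiff_sPlus hφ x X).2]; ring), dcomb]
  set f' : M → R42 := fun x => Tp x (gf x) + -q' with hf'
  set t' : M → R42 := fun x => Tp x (gt x) + -p' with ht'
  have df' : ∀ (x : M) (X : E2), vdiff f' x X = Tp x (pencil f t x (1 - lam) (-lam) X) :=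
    fun x X => by rw [hf', vdiff_add sTf contMDiff_const, vdiff_const, add_zero, hgf, dT]
  have dt' : ∀ (x : M) (X : E2), vdiff t' x X = Tp x (pencil f t x (-lam) (1 - lam) X) :=
    fun x X => by rw [ht', vdiff_add sTt contMDiff_const, vdiff_const, add_zero, hgt, dT]
  have ef : ∀ x, f' x = Tp x ((-lam) • (p + q) + (1 - lam + k) • f x - (lam + k) • t x) :=
    fun x => by
      simp only [hf', hgf]
      rw [eq x, ← (Tp x).map_neg, ← (Tp x).map_add]
      congr 1
      module
  have et : ∀ x, t' x = Tp x ((-lam) • (p + q) + (1 - lam + k) • t x - (lam + k) • f x) :=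
    fun x => by
      simp only [ht', hgt]
      rw [ep x, ← (Tp x).map_neg, ← (Tp x).map_add]
      congr 1
      module
  have N' : IsNormalPair p' q' f' t' := by
    refine ⟨sTf.add contMDiff_const, sTt.add contMDiff_const, fun x => ?_, fun x X => ?_⟩
    · have F := N.frame x
      refine ⟨?_, ?_, ?_, ?_, ?_, ?_, ?_, ?_, ?_, ?_⟩ <;>
        simp only [ep x, eq x, ef x, et x] <;> rw [orth] <;>
        simp only [ip_smul_left, ip_smul_right, ip_add_left, ip_add_right, ip_sub_right,
          ip_sub_left, F.pp, F.qq, F.ff, F.tt, F.pq, F.fp, F.fq, F.tp, F.tq, F.tf, ip_comm q p,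
          ip_comm p (f x), ip_comm q (f x), ip_comm p (t x), ip_comm q (t x), ip_comm (f x) (t x)]
      · ring
      · ring
      · linear_combination (-2) * hkl
      · linear_combination 2 * hkl
      · ring
      · linear_combination (-1) * hkl
      · linear_combination hkl
      · linear_combination (-1) * hkl
      · linear_combination hkl
      · ring
    · have a := N.perp_f x X
      have b := N.perp_t x X
      rw [df', et, orth, pencil_apply]
      simp only [ip_smul_left, ip_smul_right, ip_add_left, ip_add_right, ip_sub_right, a.p, a.q,
        a.f, a.t, b.p, b.q, b.f, b.t]
      ring
  have hspan : ∀ x, (legendreLift p q f t x).map (Tp x).toLinearMap =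
      legendreLift p' q' f' t' x := fun x => by
    have e1 : q' + f' x = (1 - lam) • Tp x (q + f x) + (-lam) • Tp x (p + t x) := by
      rw [← (Tp x).map_smul, ← (Tp x).map_smul, ← (Tp x).map_add]
      simp only [hf', hgf]
      abel
    have e2 : p' + t' x = (-lam) • Tp x (q + f x) + (1 - lam) • Tp x (p + t x) := by
      rw [← (Tp x).map_smul, ← (Tp x).map_smul, ← (Tp x).map_add]
      simp only [ht', hgt]
      abel
    rw [legendreLift, legendreLift, e1, e2, span_pair_comb hl', Submodule.map_span, Set.image_pair]
    rfl
  have hca : ∀ x, T x (q + f x) = Tp x (q + f x) ∧ T x (q + f x) = Tm x (q + f x) := fun x =>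
    hT.apply_contact x (N.ip_sPlus x).2.1 (N.ip_sMinus x).2.1
  have hcb : ∀ x, T x (p + t x) = Tp x (p + t x) ∧ T x (p + t x) = Tm x (p + t x) := fun x =>
    hT.apply_contact x (N.ip_sPlus x).1 (N.ip_sMinus x).1
  have hspan' : ∀ (x : M) (S : R42 →L[ℝ] R42), S (q + f x) = Tp x (q + f x) →
      S (p + t x) = Tp x (p + t x) → (legendreLift p q f t x).map S.toLinearMap =
      legendreLift p' q' f' t' x := fun x S h1 h2 => by
    rw [← hspan x, legendreLift, Submodule.map_span, Submodule.map_span, Set.image_pair,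
      Set.image_pair]
    simp only [ContinuousLinearMap.coe_coe, h1, h2]
  refine ⟨p', q', f', t', ⟨(N'.frame x₀).pp, (N'.frame x₀).qq, (N'.frame x₀).pq⟩,
    h.of_pencil hpq humb hl N' orth df' dt', fun x => ⟨hspan' x _ (hca x).1 (hcb x).1, hspan x,
      hspan' x _ ((hca x).2.symm.trans (hca x).1) ((hcb x).2.symm.trans (hcb x).1)⟩,
    -- By construction 𝔭' + 𝔮' = T⁺q⁺ and 𝔭' - 𝔮' = c T⁻q⁻.
    1, c, fun x => ?_⟩
  rw [hT.apply_plus N, (hT.apply_minus N x).1, ← cp x, ← cm x, hp', hq']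
  constructor <;> module

end Main

theorem mainTheorem2 {M : Type*} [TopologicalSpace M] [ChartedSpace E2 M]
    [IsManifold 𝓘(ℝ, E2) ∞ M] [ConnectedSpace M]
    (p q : R42) (hpq : IsOrthonormalPair p q)
    (f t : M → R42) (hf : IsFlatFront p q f t) (humb : ∀ x, ¬ IsUmbilic f t x) :
    (∃ φ J, IsCurvatureData f t φ J) ∧
    ∀ φ J, IsCurvatureData f t φ J →
      IsMoutardLift J (sPlus p q f t φ) ∧ IsMoutardLift J (sMinus p q f t φ) ∧
      ∀ lam : ℝ, lam ≠ 1 / 2 → ∀ Tp Tm T : M → R42 →L[ℝ] R42,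
        IsLieDeformation J (sPlus p q f t φ) (sMinus p q f t φ) lam Tp Tm T →
        ∃ (p' q' : R42) (f' t' : M → R42),
          IsOrthonormalPair p' q' ∧ IsFlatFront p' q' f' t' ∧
          (∀ x,
            (legendreLift p q f t x).map (T x).toLinearMap = legendreLift p' q' f' t' x ∧
            (legendreLift p q f t x).map (Tp x).toLinearMap = legendreLift p' q' f' t' x ∧
            (legendreLift p q f t x).map (Tm x).toLinearMap = legendreLift p' q' f' t' x) ∧
          ∃ a b : ℝ, ∀ x,
            p' + q' = a • T x (p + q +
              (lam / 2 * ip (p + q) (sMinus p q f t φ x)) • sPlus p q f t φ x) ∧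
            p' - q' = b • T x (p - q +
              (lam / 2 * ip (p - q) (sPlus p q f t φ x)) • sMinus p q f t φ x) :=
  ⟨hf.exists_isCurvatureData hpq humb, fun _ _ h =>
    ⟨h.isMoutardLift_sPlus hf.smooth_f hf.smooth_t, h.isMoutardLift_sMinus hf.smooth_f hf.smooth_t,
      fun _ hl _ _ _ hT => hf.lie_deformation hpq humb h.smooth hl hT⟩⟩
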